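/- Let $C_0=\{(x,t)\in\mathbb R^{3,1}: t=|x|,\ x\neq 0\}$ be the standard future null cone in Minkowski space (vertex removed), with polar coordinates $r=|x|>0$, $\theta=x/|x|\in S^2\subset\mathbb R^3$, written $(\rho,\zeta)$ on the target of a map $C_0\to C_0$; the degenerate metric induced on $C_0$ is $\rho^2|d\zeta|^2$. For $r>0$ let $i_r:S^2\to C_0$, $i_r(\theta)=(r\theta,r)$. A map $S^2\to C_0$ is called orientation preserving if its composition with the projection $(\rho,\zeta)\mapsto\zeta$ to $S^2$ has everywhere an orientation preserving, invertible differential. A $C^\infty$ map $\Phi:C_0\to C_0$ is called quasi-spherical if for every $r>0$ the map $\Phi\circ i_r:S^2\to C_0$ is an orientation preserving embedding that pulls $\rho^2|d\zeta|^2$ back to $r^2|d\theta|^2$. Let $\beta=\beta(r,\theta)$ be a $C^\infty$ vector field on $C_0$ tangent to the spheres $r=\mathrm{const}$, regarded as an $\mathbb R^3$-valued function with $\theta\cdot\beta=0$, which consists solely of $\ell=1$ spherical harmonics, i.e. for every $r>0$ there are $s_1(r),t_1(r)\in\mathbb R^3$ with $$\beta(r,\theta)=r\,\bigl(t_1(r)-(\theta\cdot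 t_1(r))\,\theta\bigr)+r\,\theta\times s_1(r)\qquad\text{for all }\theta\in S^2 .$$ Then there is a quasi-spherical map $\Phi:C_0\to C_0$ such that $$\Phi^*(\rho^2|d\zeta|^2)=|r\,d\theta+\beta\,dr|^2. \qquad (*)$$ Furthermore, $\Phi$ is unique up to a rigid Lorentz transformation: if $\Phi$ is a quasi-spherical map satisfying $(*)$ and $\tilde\Phi:C_0\to C_0$ is any $C^\infty$ map satisfying $(*)$ for which every $\tilde\Phi\circ i_r$, $r>0$, is orientation preserving, then there is $L_0\in SO_0(3,1)$ with $\tilde\Phi=L_0\circ\Phi$. -/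

import Mathlib

open scoped ContDiff

noncomputable section

/-- Euclidean three-space `ℝ³`. -/
abbrev Space3 : Type := EuclideanSpace ℝ (Fin 3)

/-- The vector space `ℝ^{3,1}`; a point is `(x, t)`. -/
abbrev Mink : Type := Space3 × ℝ

/-- The Minkowski bilinear form `x · y - s t`. -/
def minkForm (p q : Mink) : ℝ := inner ℝ p.1 q.1 - p.2 * q.2

/-- Membership in `SO₀(3,1)`: linear isometries of the Minkowski form with determinant one
which preserve the time orientation. -/
def IsSO0 (L : Mink →ₗ[ℝ] Mink) : Prop :=
  (∀ p q, minkForm (L p) (L q) = minkForm p q) ∧ LinearMap.det L = 1 ∧ 0 < (L (0, 1)).2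

/-- The cross product of `ℝ³`. -/
def cross3 (a b : Space3) : Space3 := WithLp.toLp 2 (crossProduct a.ofLp b.ofLp)

/-- The unit sphere `S²` in `ℝ³`. -/
abbrev S2 : Type := Metric.sphere (0 : Space3) 1

/-- The standard future null cone `t = |x|`, without its vertex. It is the domain of the polar
coordinates `r = |x|`, `θ = x / |x|`, and `x` is a global coordinate on it. -/
abbrev NullCone : Type := {p : Mink // p.2 = ‖p.1‖ ∧ p.1 ≠ 0}

/-- The point of the cone with spatial coordinate `x ≠ 0`. -/
def NullCone.ofSpace (x : Space3) (hx : x ≠ 0) : NullCone := ⟨(x, ‖x‖), rfl, hx⟩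

/-- The inclusion `i_r : S² → C₀`, `θ ↦ (r θ, r)`, for `r > 0`. -/
def sphereIncl (r : ℝ) (hr : 0 < r) (θ : S2) : NullCone :=
  ⟨(r • (θ : Space3), r), by
    have h : ‖(θ : Space3)‖ = 1 := by simp
    refine ⟨by simp [norm_smul, h, abs_of_pos hr], smul_ne_zero hr.ne' ?_⟩
    intro h0
    simp [h0] at h⟩

/-- The angular coordinate `θ = x / |x|`. -/
def angular (x : Space3) : Space3 := ‖x‖⁻¹ • x

theorem angular_mem_sphere {x : Space3} (hx : x ≠ 0) :
    angular x ∈ Metric.sphere (0 : Space3) 1 := by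
  simp [angular, norm_smul, hx]

open Classical in
/-- A map of the cone into itself, expressed in the global coordinate `x` (junk value at `0`). -/
def coneCoord (Φ : NullCone → NullCone) (x : Space3) : Space3 :=
  if hx : x ≠ 0 then (Φ (NullCone.ofSpace x hx)).1.1 else 0

open Classical in
/-- A map `S² → C₀`, expressed in the global coordinate of the cone and extended to `ℝ³ \ {0}`
as a homogeneous function of degree zero (junk value at `0`). The map is smooth on `S²` if and
only if this extension is smooth on `ℝ³ \ {0}`, and the derivatives of the extension in directions
tangent to `S²` are those of the map. -/
def sphereCoord (φ : S2 → NullCone) (x : Space3) : Space3 :=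
  if hx : x ≠ 0 then (φ ⟨angular x, angular_mem_sphere hx⟩).1.1 else 0

/-- The degenerate quadratic form `ρ² |dζ|²` of the cone at the point with coordinate `y`,
where `ρ = |y|` and `ζ = y / |y|`, evaluated at the vector `v`. -/
def coneForm (y v : Space3) : ℝ := ‖y‖ ^ 2 * ‖fderiv ℝ angular y v‖ ^ 2

/-- The quadratic form `|r dθ + β dr|²` at the point with coordinate `x = r θ`, evaluated at the
vector `v`. The field `β` is a function of `r > 0` and `θ ∈ S²`. -/
def quasiSphericalForm (β : ℝ → Space3 → Space3) (x v : Space3) : ℝ :=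
  ‖‖x‖ • fderiv ℝ angular x v + (fderiv ℝ (fun z : Space3 => ‖z‖) x v) • β ‖x‖ (angular x)‖ ^ 2

/-- A smooth angular vector field `β(r, θ)` on the cone: the shear vectors of quasi-spherical
forms. -/
def IsShearVector (β : ℝ → Space3 → Space3) : Prop :=
  ContDiffOn ℝ ∞ (fun x : Space3 => β ‖x‖ (angular x)) {0}ᶜ ∧
  ∀ r : ℝ, 0 < r → ∀ θ : Space3, ‖θ‖ = 1 → inner ℝ θ (β r θ) = 0

/-- `β` consists solely of `ℓ = 1` spherical harmonics: on each sphere it has the form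
`r (t - (θ · t) θ) + r θ × s` with `s`, `t` independent of `θ`. -/
def IsPureEllOne (β : ℝ → Space3 → Space3) : Prop :=
  ∀ r : ℝ, 0 < r → ∃ s t : Space3, ∀ θ : Space3, ‖θ‖ = 1 →
    β r θ = r • (t - (inner ℝ θ t : ℝ) • θ) + r • cross3 θ s

/-- A map `φ : S² → C₀` preserves orientation: it sends oriented tangent bases `(u, v)` of `S²`
to vectors whose angular parts are oriented tangent bases of `S²`, where `S²` is oriented by its
outer normal. -/
def PreservesOrientation (φ : S2 → NullCone) : Prop :=
  ∀ θ : Space3, ‖θ‖ = 1 → ∀ u v : Space3, inner ℝ θ u = 0 → inner ℝ θ v = 0 →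
    0 < inner ℝ θ (cross3 u v) →
    0 < inner ℝ (angular (sphereCoord φ θ))
      (cross3 (fderiv ℝ (fun x => angular (sphereCoord φ x)) θ u)
        (fderiv ℝ (fun x => angular (sphereCoord φ x)) θ v))

/-- `φ : S² → C₀` is a quasi-sphere of radius `r`: a smooth orientation preserving embedding
which pulls the form of the cone back to `r² |dθ|²`. -/
structure IsQuasiSphere (r : ℝ) (φ : S2 → NullCone) : Prop where
  smooth : ContDiffOn ℝ ∞ (sphereCoord φ) {0}ᶜ
  embedding : Topology.IsEmbedding φ
  immersion : ∀ θ : Space3, ‖θ‖ = 1 → ∀ v : Space3, inner ℝ θ v = 0 →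
    fderiv ℝ (sphereCoord φ) θ v = 0 → v = 0
  orientation : PreservesOrientation φ
  pullback : ∀ θ : Space3, ‖θ‖ = 1 → ∀ v : Space3, inner ℝ θ v = 0 →
    coneForm (sphereCoord φ θ) (fderiv ℝ (sphereCoord φ) θ v) = r ^ 2 * ‖v‖ ^ 2

/-- A smooth map of the cone into itself. -/
def IsSmoothConeMap (Φ : NullCone → NullCone) : Prop :=
  ContDiffOn ℝ ∞ (coneCoord Φ) {0}ᶜ

/-- A (smooth) quasi-spherical map `Φ : C₀ → C₀`: each `Φ ∘ i_r` is a quasi-sphere of radius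
`r`. -/
def IsQuasiSphericalMap (Φ : NullCone → NullCone) : Prop :=
  IsSmoothConeMap Φ ∧ ∀ (r : ℝ) (hr : 0 < r), IsQuasiSphere r (Φ ∘ sphereIncl r hr)

/-- `Φ^* (ρ² |dζ|²) = |r dθ + β dr|²` on the cone. -/
def PullsBackTo (Φ : NullCone → NullCone) (β : ℝ → Space3 → Space3) : Prop :=
  ∀ x : Space3, x ≠ 0 → ∀ v : Space3,
    coneForm (coneCoord Φ x) (fderiv ℝ (coneCoord Φ) x v) = quasiSphericalForm β x v

end

/-! A Lorentz transformation preserves the degenerate form of the cone, and an infinitesimal one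
moves each sphere by an ℓ = 1 field. The coefficients `t r` and `s r` of `β` are thus the boost and
rotation parts of a curve in the Lie algebra, and the problem becomes a linear ODE.

Existence. Let A(s, t) = `lorentzGen (s, t)` and solve L' = L A(s r, t r) with L 1 = id. The
solution L r stays in SO₀(3,1), and the map acting on the sphere of radius r by L r (`frameMap`) is
the required one. In its differential L r appears as an outer factor, which the Minkowski form does
not see; what is left is v + dr · A x, whose part tangent to the sphere is r dθ + β dr
(`pullsBackTo_frameMap`).

Rigidity of one sphere. Along a sphere, any solution extends by homogeneity to an isometry of the
degenerate form, and such isometries are linear (`IsConeIsometry.exists_linear`). In the section t -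
x₂ = 1 of the cone the form becomes the flat metric |dz|², so one obtains a null immersion Q of the
plane with flat metric. Its derivatives satisfy Q_xx - Q_yy = p Q and Q_xy = q Q; the Codazzi
equations are the Cauchy-Riemann equations for p - 2iq, the Schwarzian. Smoothness across the
missing point of the sphere makes it decay at infinity, so Liouville's theorem gives p = q = 0. Then
Q is a quadratic polynomial, which is what a linear map restricts to. Orientation puts the linear
map in SO₀(3,1) (`exists_isSO0_sphere`).

Linking the spheres. A solution acts on the sphere of radius r by some M r, chosen for each r
separately. The form |r dθ + β dr|² vanishes along the curves which the frame sends to fixed null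
rays (`kernelCurve`), so a solution sends these curves into rays as well. Hence M r ∘ (L r)⁻¹ and M
1 agree on null directions. Two Minkowski isometries that agree on null directions up to positive
factors agree on null vectors (`eq_of_null_directions`), so the solution is M 1 ∘ `frameMap`. Two
solutions therefore differ by a fixed Lorentz transformation. No regularity of r ↦ M r is needed. -/

noncomputable section

/-! ### Global smooth solutions of linear ordinary differential equations -/

section LinearODE

variable {E : Type*} [NormedAddCommGroup E] [NormedSpace ℝ E]

theorem norm_le_exp_of_norm_deriv_le_right {g g' : ℝ → E} {a b C : ℝ}
    (hg : ∀ t ∈ Set.Icc a b, HasDerivWithinAt g (g' t) (Set.Icc a b) t)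
    (hC : ∀ t ∈ Set.Icc a b, ‖g' t‖ ≤ C * ‖g t‖) {t₀ t : ℝ} (ht₀ : a ≤ t₀) (h : t₀ ≤ t)
    (ht : t ≤ b) : ‖g t‖ ≤ ‖g t₀‖ * Real.exp (C * (t - t₀)) := by
  have hsub : Set.Icc t₀ b ⊆ Set.Icc a b := Set.Icc_subset_Icc_left ht₀
  have := norm_le_gronwallBound_of_norm_deriv_right_le (f := g) (f' := g') (δ := ‖g t₀‖) (K := C)
    (ε := 0) (a := t₀) (b := b)
    (fun s hs => ((hg s (hsub hs)).continuousWithinAt).mono hsub)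
    (fun s hs => by
      have h1 := hg s (hsub (Set.Ico_subset_Icc_self hs))
      refine h1.mono_of_mem_nhdsWithin ?_
      exact Filter.mem_of_superset (Icc_mem_nhdsGE hs.2)
        (Set.Icc_subset_Icc_left (ht₀.trans hs.1)))
    le_rfl
    (fun s hs => by simpa using hC s (hsub (Set.Ico_subset_Icc_self hs))) t ⟨h, ht⟩
  simpa [gronwallBound_ε0] using this

/-- Grönwall's inequality in both time directions; the backward case follows by reversing time. It
gives both the a priori bound and the uniqueness used below. -/
theorem norm_le_exp_of_norm_deriv_le {g g' : ℝ → E} {a b C : ℝ}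
    (hg : ∀ t ∈ Set.Icc a b, HasDerivWithinAt g (g' t) (Set.Icc a b) t)
    (hC : ∀ t ∈ Set.Icc a b, ‖g' t‖ ≤ C * ‖g t‖) {t₀ t : ℝ} (ht₀ : t₀ ∈ Set.Icc a b)
    (ht : t ∈ Set.Icc a b) : ‖g t‖ ≤ ‖g t₀‖ * Real.exp (C * |t - t₀|) := by
  rcases le_total t₀ t with h | h
  · rw [abs_of_nonneg (sub_nonneg.2 h)]
    exact norm_le_exp_of_norm_deriv_le_right hg hC ht₀.1 h ht.2
  · rw [abs_of_nonpos (sub_nonpos.2 h)]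
    have key := norm_le_exp_of_norm_deriv_le_right (g := fun s => g (-s)) (g' := fun s => -g' (-s))
      (a := -b) (b := -a) (C := C) (t₀ := -t₀) (t := -t) ?_ ?_ (by linarith [ht₀.2]) (by linarith)
      (by linarith [ht.1])
    · simpa [neg_add_eq_sub, sub_eq_neg_add, add_comm] using key
    · intro s hs
      have hs' : -s ∈ Set.Icc a b := ⟨by linarith [hs.2], by linarith [hs.1]⟩
      have h1 := (hg (-s) hs').scomp s ((hasDerivAt_neg s).hasDerivWithinAt (s := Set.Icc (-b) (-a)))
        (fun x hx => ⟨by linarith [hx.2], by linarith [hx.1]⟩)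
      simpa using! h1
    · intro s hs
      simpa using hC (-s) ⟨by linarith [hs.2], by linarith [hs.1]⟩

/-- The radial retraction of a normed space onto the ball of radius `R`, as a scaling factor. -/
def retractScale {E : Type*} [NormedAddCommGroup E] (R : ℝ) (y : E) : ℝ := R / max R ‖y‖

theorem retractScale_nonneg {E : Type*} [NormedAddCommGroup E] {R : ℝ} (hR : 0 < R) (y : E) :
    0 ≤ retractScale R y :=
  div_nonneg hR.le (hR.le.trans (le_max_left _ _))

theorem retractScale_le_one {E : Type*} [NormedAddCommGroup E] {R : ℝ} (hR : 0 < R) (y : E) :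
    retractScale R y ≤ 1 :=
  (div_le_one (hR.trans_le (le_max_left _ _))).2 (le_max_left _ _)

theorem retractScale_eq_one {E : Type*} [NormedAddCommGroup E] {R : ℝ} (hR : 0 < R) {y : E}
    (hy : ‖y‖ ≤ R) : retractScale R y = 1 := by
  rw [retractScale, max_eq_left hy, div_self hR.ne']

theorem norm_retractScale_smul_le {R : ℝ} (hR : 0 < R) (y : E) : ‖retractScale R y • y‖ ≤ R := by
  have hm : 0 < max R ‖y‖ := hR.trans_le (le_max_left _ _)
  rw [norm_smul, Real.norm_of_nonneg (retractScale_nonneg hR y), retractScale, div_mul_eq_mul_div,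
    div_le_iff₀ hm]
  exact mul_le_mul_of_nonneg_left (le_max_right _ _) hR.le

theorem norm_retractScale_smul_le_norm {R : ℝ} (hR : 0 < R) (y : E) :
    ‖retractScale R y • y‖ ≤ ‖y‖ := by
  rw [norm_smul, Real.norm_of_nonneg (retractScale_nonneg hR y)]
  exact mul_le_of_le_one_left (norm_nonneg _) (retractScale_le_one hR y)

theorem abs_retractScale_sub_le {E : Type*} [NormedAddCommGroup E] {R : ℝ} (hR : 0 < R) (x y : E) :
    |retractScale R x - retractScale R y| ≤ ‖x - y‖ / R := by
  have hx : 0 < max R ‖x‖ := hR.trans_le (le_max_left _ _)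
  have hy : 0 < max R ‖y‖ := hR.trans_le (le_max_left _ _)
  have h1 : |max R ‖y‖ - max R ‖x‖| ≤ ‖x - y‖ := by
    rw [max_comm R, max_comm R]
    exact (abs_max_sub_max_le_abs _ _ _).trans
      ((abs_norm_sub_norm_le y x).trans (norm_sub_rev y x).le)
  have h2 : retractScale R x - retractScale R y
      = R * (max R ‖y‖ - max R ‖x‖) / (max R ‖x‖ * max R ‖y‖) := by
    unfold retractScale
    field_simp
  rw [h2, abs_div, abs_mul, abs_of_pos hR, abs_of_pos (mul_pos hx hy), div_le_div_iff₀ (mul_pos hx hy) hR]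
  have h3 : R * R ≤ max R ‖x‖ * max R ‖y‖ :=
    mul_le_mul (le_max_left _ _) (le_max_left _ _) hR.le hx.le
  nlinarith [abs_nonneg (max R ‖y‖ - max R ‖x‖), norm_nonneg (x - y), mul_pos hR hR]

/-- Picard-Lindelöf covers a prescribed interval only when the speed is bounded in terms of the
radius of the ball. The linear field is therefore composed with the retraction onto a ball of radius
R; Grönwall's bound shows afterwards that the solution never feels the truncation. -/
theorem exists_linear_ode_Icc [CompleteSpace E] {T : ℝ → E →L[ℝ] E} (hT : Continuous T) (y₀ : E) {n : ℝ}
    (hn : 0 ≤ n) : ∃ Y : ℝ → E, Y 0 = y₀ ∧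
      ∀ t ∈ Set.Icc (-n) n, HasDerivWithinAt Y (T t (Y t)) (Set.Icc (-n) n) t := by
  obtain ⟨C, hC⟩ := (isCompact_Icc (a := -n) (b := n)).exists_bound_of_continuousOn hT.continuousOn
  have h0 : (0 : ℝ) ∈ Set.Icc (-n) n := ⟨by linarith, hn⟩
  have hC0 : 0 ≤ C := (norm_nonneg _).trans (hC 0 h0)
  -- R exceeds the Grönwall bound on [-n, n]; the summand 1 keeps it positive when y₀ = 0. The
  -- radius a below is the distance travelled in time n at the maximal speed C R.
  set R : ℝ := ‖y₀‖ * Real.exp (C * n) + 1 with hRdef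
  have hR : 0 < R := by positivity
  set a : ℝ := C * R * n with ha
  have ha0 : 0 ≤ a := by positivity
  have hPL : IsPicardLindelof (fun t y => T t (retractScale R y • y)) (tmin := -n) (tmax := n)
      ⟨0, h0⟩ y₀ ⟨a, ha0⟩ 0 ⟨C * R, by positivity⟩
      ⟨C * (1 + (‖y₀‖ + a) / R), by positivity⟩ := by
    constructor
    · intro t ht
      refine LipschitzOnWith.of_dist_le_mul fun x hx y hy => ?_
      have hy' : ‖y‖ ≤ ‖y₀‖ + a := by
        have : dist y y₀ ≤ a := hy
        rw [dist_eq_norm] at this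
        linarith [norm_le_norm_add_norm_sub' y y₀]
      simp only [dist_eq_norm, ← map_sub]
      have h1 : retractScale R x • x - retractScale R y • y
          = retractScale R x • (x - y) + (retractScale R x - retractScale R y) • y := by
        module
      have h2 : ‖retractScale R x • x - retractScale R y • y‖
          ≤ (1 + (‖y₀‖ + a) / R) * ‖x - y‖ := by
        rw [h1]
        refine (norm_add_le _ _).trans ?_
        rw [norm_smul, norm_smul, Real.norm_of_nonneg (retractScale_nonneg hR x), Real.norm_eq_abs]
        have h3 := mul_le_mul_of_nonneg_right (retractScale_le_one hR x) (norm_nonneg (x - y))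
        have h4 := mul_le_mul (abs_retractScale_sub_le hR x y) hy' (norm_nonneg y) (by positivity)
        calc _ ≤ 1 * ‖x - y‖ + ‖x - y‖ / R * (‖y₀‖ + a) := add_le_add h3 h4
          _ = _ := by ring
      calc _ ≤ ‖T t‖ * ‖retractScale R x • x - retractScale R y • y‖ := (T t).le_opNorm _
        _ ≤ C * ((1 + (‖y₀‖ + a) / R) * ‖x - y‖) :=
          mul_le_mul (hC t ht) h2 (norm_nonneg _) hC0
        _ = C * (1 + (‖y₀‖ + a) / R) * ‖x - y‖ := by ring
    · intro x _
      exact (hT.clm_apply continuous_const).continuousOn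
    · intro t ht x _
      exact ((T t).le_opNorm _).trans
        (mul_le_mul (hC t ht) (norm_retractScale_smul_le hR x) (norm_nonneg _) hC0)
    · change C * R * max (n - 0) (0 - -n) ≤ a - 0
      simp [ha]
  obtain ⟨Y, hY0, hY⟩ := hPL.exists_eq_forall_mem_Icc_hasDerivWithinAt₀
  refine ⟨Y, hY0, fun t ht => ?_⟩
  have hb := norm_le_exp_of_norm_deriv_le (C := C) hY (fun s hs => ((T s).le_opNorm _).trans
    (mul_le_mul (hC s hs) (norm_retractScale_smul_le_norm hR _) (norm_nonneg _) hC0)) h0 ht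
  have hle : ‖Y t‖ ≤ R := by
    refine hb.trans ?_
    have h5 : |t - 0| ≤ n := by rw [sub_zero]; exact abs_le.2 ht
    have h6 : Real.exp (C * |t - 0|) ≤ Real.exp (C * n) :=
      Real.exp_le_exp.2 (mul_le_mul_of_nonneg_left h5 hC0)
    have h7 : Y 0 = y₀ := hY0
    rw [h7]
    linarith [mul_le_mul_of_nonneg_left h6 (norm_nonneg y₀)]
  simpa [retractScale_eq_one hR hle] using hY t ht

theorem exists_linear_ode [CompleteSpace E] {T : ℝ → E →L[ℝ] E} (hT : Continuous T) (y₀ : E) :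
    ∃ Y : ℝ → E, Y 0 = y₀ ∧ ∀ t, HasDerivAt Y (T t (Y t)) t := by
  choose Y hY0 hY using fun n : ℕ => exists_linear_ode_Icc hT y₀ (n := n) n.cast_nonneg
  have huniq : ∀ m n : ℕ, m ≤ n → ∀ t ∈ Set.Icc (-(m : ℝ)) m, Y m t = Y n t := by
    intro m n hmn t ht
    have hmn' : (m : ℝ) ≤ n := by exact_mod_cast hmn
    have hsub : Set.Icc (-(m : ℝ)) m ⊆ Set.Icc (-(n : ℝ)) n :=
      Set.Icc_subset_Icc (by linarith) hmn'
    obtain ⟨C, hC⟩ := (isCompact_Icc (a := -(m : ℝ)) (b := m)).exists_bound_of_continuousOn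
      hT.continuousOn
    have := norm_le_exp_of_norm_deriv_le (g := fun t => Y m t - Y n t) (C := C)
      (fun s hs => (hY m s hs).sub ((hY n s (hsub hs)).mono hsub))
      (fun s hs => by
        rw [← map_sub]
        exact ((T s).le_opNorm _).trans (mul_le_mul_of_nonneg_right (hC s hs) (norm_nonneg _)))
      (t₀ := 0) ⟨by simp, by simp⟩ ht
    simp only [hY0, sub_self, norm_zero, zero_mul] at this
    exact sub_eq_zero.1 (norm_le_zero_iff.1 this)
  -- The solutions on the intervals [-n, n] are compatible by uniqueness. Near each t the glued
  -- function equals one fixed Y n, with n large enough for t to be an interior point.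
  refine ⟨fun t => Y (⌈|t|⌉₊ + 1) t, hY0 _, fun t => ?_⟩
  set n := ⌈|t|⌉₊ + 2 with hn
  have hnt : |t| < n - 1 := by
    have := Nat.le_ceil |t|
    push_cast [hn]
    linarith
  have hnt' := abs_lt.1 hnt
  have hderiv : HasDerivAt (Y n) (T t (Y n t)) t :=
    (hY n t ⟨by linarith, by linarith⟩).hasDerivAt (Icc_mem_nhds (by linarith) (by linarith))
  have heq : ∀ s : ℝ, |s| < n - 1 → Y (⌈|s|⌉₊ + 1) s = Y n s := by
    intro s hs
    have hceil : ⌈|s|⌉₊ + 1 ≤ n := by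
      have h1 : ⌈|s|⌉₊ ≤ n - 1 := Nat.ceil_le.2 (by
        rw [Nat.cast_sub (by omega)]; push_cast; exact hs.le)
      omega
    refine huniq _ _ hceil s (abs_le.1 ?_)
    push_cast
    linarith [Nat.le_ceil |s|]
  have hev : (fun t => Y (⌈|t|⌉₊ + 1) t) =ᶠ[nhds t] Y n := by
    filter_upwards [continuous_abs.continuousAt.eventually_lt continuousAt_const hnt] with s hs
    exact heq s hs
  have := hderiv.congr_of_eventuallyEq hev
  simpa only [heq t hnt] using this

/-- Bootstrap: if Y is Cⁿ, then Y' = T Y is Cⁿ, so Y is Cⁿ⁺¹. -/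
theorem contDiff_of_linear_ode {T : ℝ → E →L[ℝ] E} (hT : ContDiff ℝ ∞ T) {Y : ℝ → E}
    (hY : ∀ t, HasDerivAt Y (T t (Y t)) t) : ContDiff ℝ ∞ Y := by
  rw [contDiff_infty]
  intro n
  induction n with
  | zero =>
    exact contDiff_zero.2 (continuous_iff_continuousAt.2 fun t => (hY t).continuousAt)
  | succ n ih =>
    have : ((n + 1 : ℕ) : WithTop ℕ∞) = (n : WithTop ℕ∞) + 1 := by push_cast; rfl
    rw [this, contDiff_succ_iff_deriv]
    refine ⟨fun t => (hY t).differentiableAt, by simp, ?_⟩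
    have h : deriv Y = fun t => T t (Y t) := funext fun t => (hY t).deriv
    rw [h]
    exact (hT.of_le (by exact_mod_cast le_top)).clm_apply ih

theorem exists_smooth_linear_ode [CompleteSpace E] {T : ℝ → E →L[ℝ] E} (hT : ContDiff ℝ ∞ T) (y₀ : E) :
    ∃ Y : ℝ → E, Y 0 = y₀ ∧ ContDiff ℝ ∞ Y ∧ ∀ t, HasDerivAt Y (T t (Y t)) t := by
  obtain ⟨Y, h0, hY⟩ := exists_linear_ode hT.continuous y₀
  exact ⟨Y, h0, contDiff_of_linear_ode hT hY, hY⟩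

/-- The substitution r = exp s carries the half-line to the whole line and 1 to 0. -/
theorem exists_smooth_linear_ode_Ioi [CompleteSpace E]
    {T : ℝ → E →L[ℝ] E} (hT : ContDiffOn ℝ ∞ T (Set.Ioi 0))
    (y₀ : E) : ∃ Y : ℝ → E, Y 1 = y₀ ∧ ContDiffOn ℝ ∞ Y (Set.Ioi 0) ∧
      ∀ r, 0 < r → HasDerivAt Y (T r (Y r)) r := by
  obtain ⟨Y, h0, hs, hY⟩ := exists_smooth_linear_ode
    (T := fun s => Real.exp s • T (Real.exp s))
    (Real.contDiff_exp.smul (hT.comp_contDiff Real.contDiff_exp fun s => Real.exp_pos s)) y₀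
  refine ⟨fun r => Y (Real.log r), by simpa using h0, ?_, fun r hr => ?_⟩
  · refine hs.comp_contDiffOn (Real.contDiffOn_log.mono fun r hr => ?_)
    exact (Set.mem_Ioi.1 hr).ne'
  · have := (hY (Real.log r)).scomp r (Real.hasDerivAt_log hr.ne')
    simpa [Real.exp_log hr, smul_smul, inv_mul_cancel₀ hr.ne'] using! this

end LinearODE

/-! ### Coordinates and cross product in three-space -/

section Coordinates

theorem inner_space3 (a b : Space3) : inner ℝ a b = a 0 * b 0 + a 1 * b 1 + a 2 * b 2 := by
  simp [PiLp.inner_apply, Fin.sum_univ_three, mul_comm]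

theorem norm_sq_space3 (a : Space3) : ‖a‖ ^ 2 = a 0 ^ 2 + a 1 ^ 2 + a 2 ^ 2 := by
  rw [← real_inner_self_eq_norm_sq, inner_space3]; ring

@[simp] theorem cross3_zero (a b : Space3) : cross3 a b 0 = a 1 * b 2 - a 2 * b 1 := by
  simp [cross3, cross_apply]

@[simp] theorem cross3_one (a b : Space3) : cross3 a b 1 = a 2 * b 0 - a 0 * b 2 := by
  simp [cross3, cross_apply]

@[simp] theorem cross3_two (a b : Space3) : cross3 a b 2 = a 0 * b 1 - a 1 * b 0 := by
  simp [cross3, cross_apply]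

theorem space3_ext {a b : Space3} (h0 : a 0 = b 0) (h1 : a 1 = b 1) (h2 : a 2 = b 2) : a = b := by
  ext i; fin_cases i <;> assumption

theorem inner_cross3_self (a s : Space3) : inner ℝ a (cross3 a s) = 0 := by
  rw [inner_space3]; simp; ring

theorem inner_cross3_comm (a b s : Space3) :
    inner ℝ (cross3 a s) b = -inner ℝ a (cross3 b s) := by
  simp only [inner_space3, cross3_zero, cross3_one, cross3_two]; ring

theorem cross3_smul_left (c : ℝ) (a s : Space3) : cross3 (c • a) s = c • cross3 a s := by
  apply space3_ext <;> simp <;> ring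

theorem cross3_eq_smul_of_orthogonal {z a b : Space3} (hz : ‖z‖ = 1) (ha : inner ℝ z a = 0)
    (hb : inner ℝ z b = 0) : cross3 a b = (inner ℝ z (cross3 a b) : ℝ) • z := by
  have h1 : z 0 ^ 2 + z 1 ^ 2 + z 2 ^ 2 = 1 := by rw [← norm_sq_space3, hz]; norm_num
  rw [inner_space3] at ha hb
  rw [inner_space3]
  apply space3_ext <;> simp only [cross3_zero, cross3_one, cross3_two, PiLp.smul_apply, smul_eq_mul]
  · linear_combination (-(a 1 * b 2 - a 2 * b 1)) * h1
      + (z 1 * b 2 - z 2 * b 1) * ha - (z 1 * a 2 - z 2 * a 1) * hb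
  · linear_combination (-(a 2 * b 0 - a 0 * b 2)) * h1
      + (z 2 * b 0 - z 0 * b 2) * ha - (z 2 * a 0 - z 0 * a 2) * hb
  · linear_combination (-(a 0 * b 1 - a 1 * b 0)) * h1
      + (z 0 * b 1 - z 1 * b 0) * ha - (z 0 * a 1 - z 1 * a 0) * hb

end Coordinates

/-! ### The Minkowski form and its isometries -/

section MinkForm

theorem minkForm_comm (p q : Mink) : minkForm p q = minkForm q p := by
  simp only [minkForm, real_inner_comm, mul_comm]

@[simp] theorem minkForm_add_left (p p' q : Mink) :
    minkForm (p + p') q = minkForm p q + minkForm p' q := by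
  simp only [minkForm, Prod.fst_add, Prod.snd_add, inner_add_left]; ring

@[simp] theorem minkForm_add_right (p q q' : Mink) :
    minkForm p (q + q') = minkForm p q + minkForm p q' := by
  simp only [minkForm, Prod.fst_add, Prod.snd_add, inner_add_right]; ring

@[simp] theorem minkForm_smul_left (c : ℝ) (p q : Mink) :
    minkForm (c • p) q = c * minkForm p q := by
  simp only [minkForm, Prod.smul_fst, Prod.smul_snd, real_inner_smul_left, smul_eq_mul]; ring

@[simp] theorem minkForm_smul_right (c : ℝ) (p q : Mink) :
    minkForm p (c • q) = c * minkForm p q := by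
  simp only [minkForm, Prod.smul_fst, Prod.smul_snd, real_inner_smul_right, smul_eq_mul]; ring

@[simp] theorem minkForm_neg_left (p q : Mink) : minkForm (-p) q = -minkForm p q := by
  simpa using minkForm_smul_left (-1) p q

@[simp] theorem minkForm_neg_right (p q : Mink) : minkForm p (-q) = -minkForm p q := by
  simpa using minkForm_smul_right (-1) p q

@[simp] theorem minkForm_sub_left (p p' q : Mink) :
    minkForm (p - p') q = minkForm p q - minkForm p' q := by
  simp [sub_eq_add_neg]

@[simp] theorem minkForm_sub_right (p q q' : Mink) :
    minkForm p (q - q') = minkForm p q - minkForm p q' := by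
  simp [sub_eq_add_neg]

@[simp] theorem minkForm_zero_left (q : Mink) : minkForm 0 q = 0 := by simp [minkForm]

@[simp] theorem minkForm_zero_right (q : Mink) : minkForm q 0 = 0 := by simp [minkForm]

theorem minkForm_self (p : Mink) : minkForm p p = ‖p.1‖ ^ 2 - p.2 ^ 2 := by
  rw [minkForm, real_inner_self_eq_norm_sq]; ring

/-- Pairing p with its time reflection gives the squared Euclidean length. -/
theorem eq_zero_of_minkForm {p : Mink} (h : ∀ q, minkForm p q = 0) : p = 0 := by
  have h1 := h (p.1, -p.2)
  simp only [minkForm, real_inner_self_eq_norm_sq] at h1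
  have h2 : ‖p.1‖ = 0 := by nlinarith [norm_nonneg p.1, sq_nonneg p.2]
  have h3 : p.2 = 0 := by nlinarith [norm_nonneg p.1, sq_nonneg p.2]
  exact Prod.ext (norm_eq_zero.1 h2) h3

/-- Linear isometries of the Minkowski form. -/
def IsMinkIsometry (L : Mink →ₗ[ℝ] Mink) : Prop := ∀ p q, minkForm (L p) (L q) = minkForm p q

theorem IsMinkIsometry.injective {L : Mink →ₗ[ℝ] Mink} (hL : IsMinkIsometry L) :
    Function.Injective L := by
  rw [injective_iff_map_eq_zero]
  intro p hp
  refine eq_zero_of_minkForm fun q => ?_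
  rw [← hL, hp, minkForm_zero_left]

theorem IsMinkIsometry.exists_inverse {L : Mink →ₗ[ℝ] Mink} (hL : IsMinkIsometry L) :
    ∃ K : Mink →ₗ[ℝ] Mink, IsMinkIsometry K ∧ L ∘ₗ K = LinearMap.id ∧ K ∘ₗ L = LinearMap.id := by
  set e := LinearEquiv.ofInjectiveEndo L hL.injective with he
  have h1 : ∀ p, L (e.symm p) = p := fun p => e.apply_symm_apply p
  have h2 : ∀ p, e.symm (L p) = p := fun p => e.symm_apply_apply p
  refine ⟨e.symm, fun p q => ?_, LinearMap.ext h1, LinearMap.ext h2⟩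
  rw [← hL]
  simp only [LinearEquiv.coe_coe, h1]

theorem IsMinkIsometry.comp {L K : Mink →ₗ[ℝ] Mink} (hL : IsMinkIsometry L)
    (hK : IsMinkIsometry K) : IsMinkIsometry (L ∘ₗ K) := fun p q => (hL _ _).trans (hK p q)

/-- A Minkowski isometry preserving the time orientation maps future causal vectors to vectors
with positive time component. -/
theorem IsMinkIsometry.snd_pos {L : Mink →ₗ[ℝ] Mink} (hL : IsMinkIsometry L)
    (h0 : 0 < (L (0, 1)).2) {q : Mink} (hq : q ≠ 0) (hc : ‖q.1‖ ≤ q.2) : 0 < (L q).2 := by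
  have hq2 : 0 < q.2 := by
    rcases (norm_nonneg q.1).eq_or_lt with h | h
    · refine lt_of_le_of_ne ((norm_nonneg q.1).trans hc) fun h2 => hq ?_
      exact Prod.ext (norm_eq_zero.1 h.symm) h2.symm
    · exact h.trans_le hc
  by_contra! hneg
  -- Causal vectors with opposite time orientations have nonnegative product by Cauchy-Schwarz,
  -- whereas this product is negative.
  have h1 : minkForm (L q) (L (0, 1)) = -q.2 := by rw [hL]; simp [minkForm]
  have h2 : minkForm (L (0, 1)) (L (0, 1)) = -1 := by rw [hL]; simp [minkForm]
  have h3 : minkForm (L q) (L q) ≤ 0 := by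
    rw [hL, minkForm_self]; nlinarith [norm_nonneg q.1]
  rw [minkForm_self] at h2 h3
  set a := L q
  set b := L (0, 1)
  have h4 : ‖b.1‖ ≤ b.2 := abs_le_of_sq_le_sq' (by linarith) h0.le |>.2
  have h5 : ‖a.1‖ ≤ -a.2 := abs_le_of_sq_le_sq' (by linarith [neg_sq a.2]) (by linarith) |>.2
  have h6 : -(‖a.1‖ * ‖b.1‖) ≤ inner ℝ a.1 b.1 := (abs_le.1 (abs_real_inner_le_norm a.1 b.1)).1
  have h7 : ‖a.1‖ * ‖b.1‖ ≤ -a.2 * b.2 := mul_le_mul h5 h4 (norm_nonneg _) (by linarith)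
  rw [minkForm] at h1
  linarith

theorem IsMinkIsometry.map_null {L : Mink →ₗ[ℝ] Mink} (hL : IsMinkIsometry L)
    (h0 : 0 < (L (0, 1)).2) {x : Space3} (hx : x ≠ 0) :
    (L (x, ‖x‖)).2 = ‖(L (x, ‖x‖)).1‖ ∧ (L (x, ‖x‖)).1 ≠ 0 := by
  have h1 := hL.snd_pos h0 (q := (x, ‖x‖)) (fun h => hx (congrArg Prod.fst h)) le_rfl
  have h2 := hL (x, ‖x‖) (x, ‖x‖)
  rw [minkForm_self, minkForm_self] at h2
  have h3 : (L (x, ‖x‖)).2 = ‖(L (x, ‖x‖)).1‖ := by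
    rw [← sq_eq_sq₀ h1.le (norm_nonneg _)]
    simp only at h2
    linarith
  refine ⟨h3, fun h => ?_⟩
  rw [h3, h, norm_zero] at h1
  exact lt_irrefl _ h1

end MinkForm

/-! ### Determinants and orientation in Minkowski space -/

section Determinant

/-- Cartesian coordinates on Minkowski space. -/
def minkEquivFun : Mink ≃ₗ[ℝ] (Fin 4 → ℝ) where
  toFun p := ![p.1 0, p.1 1, p.1 2, p.2]
  map_add' p q := by ext i; fin_cases i <;> simp
  map_smul' c p := by ext i; fin_cases i <;> simp
  invFun f := (!₂[f 0, f 1, f 2], f 3)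
  left_inv p := by
    refine Prod.ext (space3_ext ?_ ?_ ?_) ?_ <;> simp
  right_inv f := by ext i; fin_cases i <;> simp

/-- The standard basis of Minkowski space. -/
def minkBasis : Module.Basis (Fin 4) ℝ Mink := .ofEquivFun minkEquivFun

theorem minkBasis_det (v : Fin 4 → Mink) :
    minkBasis.det v = (v 3).2 * inner ℝ (v 0).1 (cross3 (v 1).1 (v 2).1)
      - (v 2).2 * inner ℝ (v 0).1 (cross3 (v 1).1 (v 3).1)
      + (v 1).2 * inner ℝ (v 0).1 (cross3 (v 2).1 (v 3).1)
      - (v 0).2 * inner ℝ (v 1).1 (cross3 (v 2).1 (v 3).1) := by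
  have h : minkBasis.toMatrix v = Matrix.of fun i j => ![(v j).1 0, (v j).1 1, (v j).1 2, (v j).2] i := by
    ext i j
    simp [Module.Basis.toMatrix_apply, minkBasis, minkEquivFun]
  rw [Module.Basis.det_apply, h]
  simp [Matrix.det_succ_row_zero, Fin.sum_univ_succ, inner_space3, Fin.succAbove, Matrix.submatrix]
  ring

/-- Compare the volume of the frame (rθ, r), (ru, 0), (rv, 0), (0, 1) with that of its image. The
components along the generator (z, 1) drop out, and a × b is a multiple of z. This ties the
orientation of the angular map to the sign of det L. -/
theorem det_orientation {L : Mink →ₗ[ℝ] Mink} {r ρ ρ₁ ρ₂ : ℝ} {θ u v z a b : Space3} (hz : ‖z‖ = 1)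
    (ha : inner ℝ z a = 0) (hb : inner ℝ z b = 0)
    (h0 : L (r • θ, r) = (ρ • z, ρ)) (h1 : L (r • u, 0) = (ρ₁ • z + ρ • a, ρ₁))
    (h2 : L (r • v, 0) = (ρ₂ • z + ρ • b, ρ₂)) :
    ρ ^ 3 * ((L (0, 1)).2 - inner ℝ z (L (0, 1)).1) * inner ℝ z (cross3 a b)
      = LinearMap.det L * (r ^ 3 * inner ℝ θ (cross3 u v)) := by
  have h := minkBasis.det_comp L ![(r • θ, r), (r • u, 0), (r • v, 0), (0, 1)]
  rw [minkBasis_det, minkBasis_det] at h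
  have hc := cross3_eq_smul_of_orthogonal hz ha hb
  set k : ℝ := inner ℝ z (cross3 a b) with hk
  simp only [Function.comp_apply, Matrix.cons_val_zero, Matrix.cons_val_one, Matrix.cons_val, h0,
    h1, h2] at h
  generalize L (0, 1) = w at h ⊢
  have c0 := congrArg (fun x : Space3 => x 0) hc
  have c1 := congrArg (fun x : Space3 => x 1) hc
  have c2 := congrArg (fun x : Space3 => x 2) hc
  simp only [cross3_zero, cross3_one, cross3_two, PiLp.smul_apply, smul_eq_mul, inner_space3,
    PiLp.add_apply, PiLp.zero_apply] at h hk c0 c1 c2 ⊢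
  linear_combination h + ρ ^ 3 * w.2 * hk +
    ρ ^ 3 * (w.1 0 * c0 + w.1 1 * c1 + w.1 2 * c2)

end Determinant

/-! ### Calculus of polar coordinates and the degenerate form -/

section Angular

theorem norm_angular {x : Space3} (hx : x ≠ 0) : ‖angular x‖ = 1 := by
  simpa using angular_mem_sphere hx

theorem norm_smul_angular (x : Space3) : ‖x‖ • angular x = x := by
  by_cases hx : x = 0
  · simp [hx]
  · rw [angular, smul_smul, mul_inv_cancel₀ (norm_ne_zero_iff.2 hx), one_smul]

theorem angular_ne_zero {x : Space3} (hx : x ≠ 0) : angular x ≠ 0 :=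
  norm_ne_zero_iff.1 (by rw [norm_angular hx]; exact one_ne_zero)

theorem angular_smul {c : ℝ} (hc : 0 < c) (x : Space3) : angular (c • x) = angular x := by
  rw [angular, angular, norm_smul, Real.norm_of_nonneg hc.le, smul_smul, mul_inv_rev, mul_assoc,
    inv_mul_cancel₀ hc.ne', mul_one]

theorem angular_eq_self {x : Space3} (hx : ‖x‖ = 1) : angular x = x := by simp [angular, hx]

theorem hasFDerivAt_norm_space3 {x : Space3} (hx : x ≠ 0) :
    HasFDerivAt (fun z : Space3 => ‖z‖) (innerSL ℝ (angular x)) x := by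
  have h := (hasStrictFDerivAt_norm_sq x).hasFDerivAt.sqrt
    (pow_ne_zero 2 (norm_ne_zero_iff.2 hx))
  simp only [Real.sqrt_sq (norm_nonneg _)] at h
  refine h.congr_fderiv ?_
  ext v
  simp only [smul_apply, innerSL_apply_apply, angular, real_inner_smul_left,
    smul_eq_mul, nsmul_eq_mul]
  field_simp
  simp

theorem fderiv_norm_space3 {x : Space3} (hx : x ≠ 0) (v : Space3) :
    fderiv ℝ (fun z : Space3 => ‖z‖) x v = inner ℝ (angular x) v := by
  rw [(hasFDerivAt_norm_space3 hx).fderiv, innerSL_apply_apply]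

theorem contDiffOn_angular : ContDiffOn ℝ ∞ angular {0}ᶜ := by
  intro x hx
  exact ((contDiffAt_norm ℝ hx).inv (norm_ne_zero_iff.2 hx)).smul contDiffAt_id
    |>.contDiffWithinAt

theorem differentiableAt_angular {x : Space3} (hx : x ≠ 0) : DifferentiableAt ℝ angular x :=
  (contDiffOn_angular.contDiffAt (isOpen_compl_singleton.mem_nhds hx)).differentiableAt (by simp)

/-- Differentiate the identity ‖x‖ • angular x = x by the product rule and solve. -/
theorem fderiv_angular {x : Space3} (hx : x ≠ 0) (v : Space3) :
    fderiv ℝ angular x v = ‖x‖⁻¹ • (v - (inner ℝ (angular x) v : ℝ) • angular x) := by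
  have hn := norm_ne_zero_iff.2 hx
  have h1 : HasFDerivAt (fun z : Space3 => ‖z‖ • angular z)
      (‖x‖ • fderiv ℝ angular x + (innerSL ℝ (angular x)).smulRight (angular x)) x :=
    (hasFDerivAt_norm_space3 hx).smul (differentiableAt_angular hx).hasFDerivAt
  simp only [norm_smul_angular] at h1
  have h2 := congrArg (fun T : Space3 →L[ℝ] Space3 => T v) (h1.unique (hasFDerivAt_id x))
  simp only [add_apply, smul_apply,
    ContinuousLinearMap.smulRight_apply, innerSL_apply_apply, ContinuousLinearMap.id_apply] at h2
  rw [← eq_sub_iff_add_eq] at h2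
  rw [← h2, smul_smul, inv_mul_cancel₀ hn, one_smul]

theorem inner_angular_fderiv_angular {x : Space3} (hx : x ≠ 0) (v : Space3) :
    inner ℝ (angular x) (fderiv ℝ angular x v) = 0 := by
  rw [fderiv_angular hx, inner_smul_right, inner_sub_right, inner_smul_right,
    real_inner_self_eq_norm_sq, norm_angular hx]
  ring

theorem norm_sub_inner_smul_sq {z : Space3} (hz : ‖z‖ = 1) (v : Space3) :
    ‖v - (inner ℝ z v : ℝ) • z‖ ^ 2 = ‖v‖ ^ 2 - inner ℝ z v ^ 2 := by
  rw [@norm_sub_sq ℝ, norm_smul, hz, inner_smul_right, real_inner_comm]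
  simp
  ring

theorem coneForm_eq {y : Space3} (hy : y ≠ 0) (v : Space3) :
    coneForm y v = ‖v‖ ^ 2 - inner ℝ (angular y) v ^ 2 := by
  rw [coneForm, fderiv_angular hy, norm_smul, mul_pow, ← mul_assoc, norm_inv, norm_norm,
    inv_pow, mul_inv_cancel₀ (pow_ne_zero 2 (norm_ne_zero_iff.2 hy)), one_mul,
    norm_sub_inner_smul_sq (norm_angular hy)]

/-- The pair on the right is the lift of v to a vector tangent to the cone; the degenerate form is
the Minkowski form restricted to such vectors. -/
theorem coneForm_eq_minkForm {y : Space3} (hy : y ≠ 0) (v : Space3) :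
    coneForm y v = minkForm (v, inner ℝ (angular y) v) (v, inner ℝ (angular y) v) := by
  rw [coneForm_eq hy, minkForm_self]

theorem quasiSphericalForm_eq (β : ℝ → Space3 → Space3) {x : Space3} (hx : x ≠ 0) (v : Space3) :
    quasiSphericalForm β x v = ‖v - (inner ℝ (angular x) v : ℝ) • angular x
      + (inner ℝ (angular x) v : ℝ) • β ‖x‖ (angular x)‖ ^ 2 := by
  rw [quasiSphericalForm, fderiv_angular hx, fderiv_norm_space3 hx, smul_smul,
    mul_inv_cancel₀ (norm_ne_zero_iff.2 hx), one_smul]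

end Angular

/-! ### Maps of the cone as maps into Minkowski space -/

section ConeMaps

/-- A map of the cone into itself as a map from the global coordinate into Minkowski space. -/
def coneLift (Φ : NullCone → NullCone) (x : Space3) : Mink := (coneCoord Φ x, ‖coneCoord Φ x‖)

theorem coneCoord_eq (Φ : NullCone → NullCone) {x : Space3} (hx : x ≠ 0) :
    coneCoord Φ x = (Φ (NullCone.ofSpace x hx)).1.1 := by
  simp [coneCoord, hx]

theorem coneCoord_ne_zero (Φ : NullCone → NullCone) {x : Space3} (hx : x ≠ 0) :
    coneCoord Φ x ≠ 0 := by
  rw [coneCoord_eq Φ hx]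
  exact (Φ _).2.2

theorem coneLift_eq (Φ : NullCone → NullCone) {x : Space3} (hx : x ≠ 0) :
    coneLift Φ x = Φ (NullCone.ofSpace x hx) := by
  rw [coneLift, coneCoord_eq Φ hx]
  exact Prod.ext rfl (Φ _).2.1.symm

theorem IsSmoothConeMap.contDiffAt {Φ : NullCone → NullCone} (h : IsSmoothConeMap Φ) {x : Space3}
    (hx : x ≠ 0) : ContDiffAt ℝ ∞ (coneCoord Φ) x :=
  ContDiffOn.contDiffAt h (isOpen_compl_singleton.mem_nhds hx)

theorem IsSmoothConeMap.contDiffAt_coneLift {Φ : NullCone → NullCone} (h : IsSmoothConeMap Φ)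
    {x : Space3} (hx : x ≠ 0) : ContDiffAt ℝ ∞ (coneLift Φ) x :=
  (h.contDiffAt hx).prodMk ((h.contDiffAt hx).norm ℝ (coneCoord_ne_zero Φ hx))

theorem IsSmoothConeMap.differentiableAt {Φ : NullCone → NullCone} (h : IsSmoothConeMap Φ)
    {x : Space3} (hx : x ≠ 0) : DifferentiableAt ℝ (coneCoord Φ) x :=
  (h.contDiffAt hx).differentiableAt (by simp)

theorem hasFDerivAt_nullLift {E : Type*} [NormedAddCommGroup E] [NormedSpace ℝ E] {y : E → Space3}
    {y' : E →L[ℝ] Space3} {x : E} (hy : HasFDerivAt y y' x) (h0 : y x ≠ 0) :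
    HasFDerivAt (fun z => ((y z, ‖y z‖) : Mink))
      (y'.prod ((innerSL ℝ (angular (y x))).comp y')) x :=
  hy.prodMk ((hasFDerivAt_norm_space3 h0).comp x hy)

theorem coneForm_fderiv {Φ : NullCone → NullCone} (h : IsSmoothConeMap Φ) {x : Space3}
    (hx : x ≠ 0) (v : Space3) :
    coneForm (coneCoord Φ x) (fderiv ℝ (coneCoord Φ) x v)
      = minkForm (fderiv ℝ (coneLift Φ) x v) (fderiv ℝ (coneLift Φ) x v) := by
  have h0 := coneCoord_ne_zero Φ hx
  have hd : HasFDerivAt (coneLift Φ) _ x :=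
    hasFDerivAt_nullLift (h.differentiableAt hx).hasFDerivAt h0
  rw [coneForm_eq_minkForm h0, hd.fderiv]
  rfl

theorem ofSpace_smul_angular {x : Space3} (hx : x ≠ 0) {r : ℝ} (hr : 0 < r) :
    sphereIncl r hr ⟨angular x, angular_mem_sphere hx⟩
      = NullCone.ofSpace (r • angular x) (smul_ne_zero hr.ne' (angular_ne_zero hx)) := by
  apply Subtype.ext
  simp [sphereIncl, NullCone.ofSpace, norm_smul, norm_angular hx, abs_of_pos hr]

theorem sphereCoord_comp_sphereIncl (Φ : NullCone → NullCone) {r : ℝ} (hr : 0 < r) {x : Space3}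
    (hx : x ≠ 0) : sphereCoord (Φ ∘ sphereIncl r hr) x = coneCoord Φ (r • angular x) := by
  have h1 : r • angular x ≠ 0 := smul_ne_zero hr.ne' (angular_ne_zero hx)
  rw [sphereCoord, dif_pos hx, coneCoord_eq Φ h1, Function.comp_apply, ofSpace_smul_angular hx hr]

theorem sphereCoord_eventuallyEq (Φ : NullCone → NullCone) {r : ℝ} (hr : 0 < r) {x : Space3}
    (hx : x ≠ 0) : sphereCoord (Φ ∘ sphereIncl r hr) =ᶠ[nhds x]
      fun z => coneCoord Φ (r • angular z) := by
  filter_upwards [isOpen_compl_singleton.mem_nhds hx] with z hz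
  exact sphereCoord_comp_sphereIncl Φ hr hz

theorem fderiv_angular_tangent {θ : Space3} (hθ : ‖θ‖ = 1) {v : Space3} (hv : inner ℝ θ v = 0) :
    fderiv ℝ angular θ v = v := by
  have h0 : θ ≠ 0 := norm_ne_zero_iff.1 (by rw [hθ]; exact one_ne_zero)
  rw [fderiv_angular h0, angular_eq_self hθ, hv, hθ]
  simp

theorem hasFDerivAt_sphereCoord {Φ : NullCone → NullCone} (h : IsSmoothConeMap Φ) {r : ℝ}
    (hr : 0 < r) {θ : Space3} (hθ : ‖θ‖ = 1) :
    HasFDerivAt (sphereCoord (Φ ∘ sphereIncl r hr))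
      ((fderiv ℝ (coneCoord Φ) (r • θ)).comp (r • fderiv ℝ angular θ)) θ := by
  have h0 : θ ≠ 0 := norm_ne_zero_iff.1 (by rw [hθ]; exact one_ne_zero)
  have h1 : r • angular θ ≠ 0 := smul_ne_zero hr.ne' (angular_ne_zero h0)
  have h2 := (h.differentiableAt h1).hasFDerivAt.comp θ
    ((differentiableAt_angular h0).hasFDerivAt.const_smul r)
  rw [angular_eq_self hθ] at h2
  exact h2.congr_of_eventuallyEq (sphereCoord_eventuallyEq Φ hr h0)

theorem fderiv_sphereCoord_tangent {Φ : NullCone → NullCone} (h : IsSmoothConeMap Φ) {r : ℝ}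
    (hr : 0 < r) {θ : Space3} (hθ : ‖θ‖ = 1) {v : Space3} (hv : inner ℝ θ v = 0) :
    fderiv ℝ (sphereCoord (Φ ∘ sphereIncl r hr)) θ v
      = fderiv ℝ (coneCoord Φ) (r • θ) (r • v) := by
  rw [(hasFDerivAt_sphereCoord h hr hθ).fderiv]
  simp [fderiv_angular_tangent hθ hv]

end ConeMaps

/-! ### Directional derivatives on the plane -/

section DirectionalDerivative

variable {E : Type*} [NormedAddCommGroup E] [NormedSpace ℝ E]

/-- The derivative of a function on the plane in the direction `a`. -/
def planeDeriv (a : ℂ) (F : ℂ → E) (z : ℂ) : E := fderiv ℝ F z a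

theorem contDiff_planeDeriv {F : ℂ → E} (hF : ContDiff ℝ ∞ F) (a : ℂ) :
    ContDiff ℝ ∞ (planeDeriv a F) :=
  (hF.fderiv_right (by simp)).clm_apply contDiff_const

theorem ContDiff.differentiableAt_infty {F : ℂ → E} (hF : ContDiff ℝ ∞ F) (z : ℂ) :
    DifferentiableAt ℝ F z := (hF.differentiable (by simp)) z

theorem planeDeriv_comm {F : ℂ → E} (hF : ContDiff ℝ ∞ F) (a b : ℂ) :
    planeDeriv a (planeDeriv b F) = planeDeriv b (planeDeriv a F) := by
  have hd : Differentiable ℝ (fderiv ℝ F) := (hF.fderiv_right (m := ∞) (by simp)).differentiable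
    (by simp)
  have key : ∀ a b z, planeDeriv a (planeDeriv b F) z = fderiv ℝ (fderiv ℝ F) z a b := by
    intro a b z
    have h := (hd z).hasFDerivAt.clm_apply (hasFDerivAt_const b z)
    have h' : planeDeriv a (planeDeriv b F) z = _ := congrArg (fun T => T a) h.fderiv
    simpa using h'
  funext z
  rw [key, key]
  exact (hF.contDiffAt.isSymmSndFDerivAt (by
    rw [minSmoothness_of_isRCLikeNormedField]; exact WithTop.coe_le_coe.2 le_top)) a b

theorem planeDeriv_const (a : ℂ) (c : E) (z : ℂ) : planeDeriv a (fun _ => c) z = 0 := by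
  simp [planeDeriv]

theorem planeDeriv_add {F G : ℂ → E} {z : ℂ} (hF : DifferentiableAt ℝ F z)
    (hG : DifferentiableAt ℝ G z) (a : ℂ) :
    planeDeriv a (fun z => F z + G z) z = planeDeriv a F z + planeDeriv a G z := by
  simp [planeDeriv, fderiv_fun_add hF hG]

theorem planeDeriv_sub {F G : ℂ → E} {z : ℂ} (hF : DifferentiableAt ℝ F z)
    (hG : DifferentiableAt ℝ G z) (a : ℂ) :
    planeDeriv a (fun z => F z - G z) z = planeDeriv a F z - planeDeriv a G z := by
  simp [planeDeriv, fderiv_fun_sub hF hG]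

theorem planeDeriv_smul {f : ℂ → ℝ} {G : ℂ → E} {z : ℂ} (hf : DifferentiableAt ℝ f z)
    (hG : DifferentiableAt ℝ G z) (a : ℂ) :
    planeDeriv a (fun z => f z • G z) z = planeDeriv a f z • G z + f z • planeDeriv a G z := by
  simp [planeDeriv, fderiv_fun_smul hf hG, add_comm]

theorem eq_of_planeDeriv_eq {F G : ℂ → E} (hF : Differentiable ℝ F) (hG : Differentiable ℝ G)
    (h1 : ∀ z, planeDeriv 1 F z = planeDeriv 1 G z)
    (h2 : ∀ z, planeDeriv Complex.I F z = planeDeriv Complex.I G z) (h0 : F 0 = G 0) : F = G := by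
  refine eq_of_fderiv_eq (𝕜 := ℝ) hF hG (fun z => ?_) 0 h0
  ext a
  have ha : a = a.re • (1 : ℂ) + a.im • Complex.I := by
    apply Complex.ext <;> simp
  rw [ha, map_add, map_add, map_smul, map_smul, map_smul, map_smul]
  have h1' := h1 z
  have h2' := h2 z
  unfold planeDeriv at h1' h2'
  rw [h1', h2']

/-- The Minkowski form as a continuous bilinear map. -/
def minkFormL : Mink →L[ℝ] Mink →L[ℝ] ℝ :=
  LinearMap.toContinuousLinearMap <|
    (LinearMap.toContinuousLinearMap (𝕜 := ℝ) (E := Mink) (F' := ℝ)).toLinearMap ∘ₗ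
      LinearMap.mk₂ ℝ minkForm minkForm_add_left minkForm_smul_left minkForm_add_right
        minkForm_smul_right

@[simp] theorem minkFormL_apply (p q : Mink) : minkFormL p q = minkForm p q := rfl

theorem planeDeriv_minkForm {F G : ℂ → Mink} {z : ℂ} (hF : DifferentiableAt ℝ F z)
    (hG : DifferentiableAt ℝ G z) (a : ℂ) :
    planeDeriv a (fun z => minkForm (F z) (G z)) z
      = minkForm (planeDeriv a F z) (G z) + minkForm (F z) (planeDeriv a G z) := by
  have h := minkFormL.hasFDerivAt_of_bilinear hF.hasFDerivAt hG.hasFDerivAt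
  have h' : planeDeriv a (fun z => minkForm (F z) (G z)) z = _ := congrArg (fun T => T a) h.fderiv
  rw [h']
  simp [planeDeriv, add_comm]

theorem contDiff_minkForm {F G : ℂ → Mink} (hF : ContDiff ℝ ∞ F) (hG : ContDiff ℝ ∞ G) :
    ContDiff ℝ ∞ fun z => minkForm (F z) (G z) :=
  (minkFormL.contDiff.comp hF).clm_apply hG

theorem planeDeriv_minkForm_eq_zero {F G : ℂ → Mink} (hF : ContDiff ℝ ∞ F) (hG : ContDiff ℝ ∞ G)
    {c : ℝ} (h : ∀ z, minkForm (F z) (G z) = c) (a z : ℂ) :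
    minkForm (planeDeriv a F z) (G z) + minkForm (F z) (planeDeriv a G z) = 0 := by
  rw [← planeDeriv_minkForm (hF.differentiableAt_infty z) (hG.differentiableAt_infty z)]
  simp only [h, planeDeriv_const]

end DirectionalDerivative

/-! ### Null frames -/

section NullFrame

/-- In a frame `(Q, e, f, N)` of Minkowski space with `Q` null, the vectors orthogonal to
`Q`, `e`, `f` are the multiples of `Q`. -/
theorem eq_smul_of_orthogonal_frame {Q e f N X : Mink} (hQQ : minkForm Q Q = 0)
    (hQe : minkForm Q e = 0) (hQf : minkForm Q f = 0) (hee : minkForm e e = 1)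
    (hff : minkForm f f = 1) (hef : minkForm e f = 0) (hQN : minkForm Q N = -1)
    (heN : minkForm e N = 0) (hfN : minkForm f N = 0) (hQX : minkForm Q X = 0)
    (heX : minkForm e X = 0) (hfX : minkForm f X = 0) : X = (-minkForm N X) • Q := by
  have heQ : minkForm e Q = 0 := by rw [minkForm_comm, hQe]
  have hfQ : minkForm f Q = 0 := by rw [minkForm_comm, hQf]
  have hfe : minkForm f e = 0 := by rw [minkForm_comm, hef]
  have hNQ : minkForm N Q = -1 := by rw [minkForm_comm, hQN]
  -- Pairing a linear relation with Q, e, f, N recovers each coefficient in turn, so the frame is a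
  -- basis.
  have hli : LinearIndependent ℝ ![Q, e, f, N] := by
    rw [Fintype.linearIndependent_iff]
    intro g hg
    simp only [Fin.sum_univ_four, Matrix.cons_val] at hg
    have a0 := congrArg (minkForm Q) hg
    have a1 := congrArg (minkForm e) hg
    have a2 := congrArg (minkForm f) hg
    have a3 := congrArg (fun y => minkForm y N) hg
    simp only [minkForm_add_left, minkForm_add_right, minkForm_smul_left, minkForm_smul_right,
      minkForm_zero_left, minkForm_zero_right, hQQ, hQe, hQf, hee, hff, hef, hQN, heN, hfN, heQ,
      hfQ, hfe] at a0 a1 a2 a3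
    have b3 : g 3 = 0 := by linarith
    have b0 : g 0 = 0 := by rw [b3] at a3; linarith
    intro i
    fin_cases i
    · exact b0
    · change g 1 = 0; linarith
    · change g 2 = 0; linarith
    · exact b3
  have hspan : Submodule.span ℝ (Set.range ![Q, e, f, N]) = ⊤ :=
    hli.span_eq_top_of_card_eq_finrank' (by simp)
  -- This combination is orthogonal to N as well, since N · Q = -1, hence to the whole basis.
  have hz : X + minkForm N X • Q = 0 := by
    refine eq_zero_of_minkForm fun w => ?_
    have hw : w ∈ Submodule.span ℝ (Set.range ![Q, e, f, N]) := by rw [hspan]; trivial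
    induction hw using Submodule.span_induction with
    | mem x hx =>
      obtain ⟨i, rfl⟩ := hx
      rw [minkForm_comm]
      fin_cases i <;> simp [hQX, heX, hfX, hQQ, heQ, hfQ, hNQ]
    | zero => simp
    | add x y _ _ hx hy => rw [minkForm_add_right, hx, hy, add_zero]
    | smul c x _ hx => rw [minkForm_smul_right, hx, mul_zero]
  rw [neg_smul]
  exact eq_neg_of_add_eq_zero_left hz

end NullFrame

/-! ### Flat null immersions of the plane: Gauss and Codazzi equations, Schwarzian -/

section NullImmersion

/-- A map of the Euclidean plane into the light cone which is isometric for the degenerate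
induced metric. -/
structure IsFlatNull (Q : ℂ → Mink) : Prop where
  smooth : ContDiff ℝ ∞ Q
  null : ∀ z, minkForm (Q z) (Q z) = 0
  one_one : ∀ z, minkForm (planeDeriv 1 Q z) (planeDeriv 1 Q z) = 1
  I_I : ∀ z, minkForm (planeDeriv Complex.I Q z) (planeDeriv Complex.I Q z) = 1
  one_I : ∀ z, minkForm (planeDeriv 1 Q z) (planeDeriv Complex.I Q z) = 0

open Complex (I)

/-- Half the Laplacian. -/
def halfLaplacian (Q : ℂ → Mink) (z : ℂ) : Mink :=
  (1 / 2 : ℝ) • (planeDeriv 1 (planeDeriv 1 Q) z + planeDeriv I (planeDeriv I Q) z)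

/-- The difference of the pure second derivatives. -/
def hessDiff (Q : ℂ → Mink) (z : ℂ) : Mink :=
  planeDeriv 1 (planeDeriv 1 Q) z - planeDeriv I (planeDeriv I Q) z

/-- The mixed second derivative. -/
def hessMixed (Q : ℂ → Mink) : ℂ → Mink := planeDeriv I (planeDeriv 1 Q)

/-- The factor `p` in `hessDiff Q = p • Q`. -/
def hessDiffCoeff (Q : ℂ → Mink) (z : ℂ) : ℝ := -minkForm (halfLaplacian Q z) (hessDiff Q z)

/-- The factor `q` in `hessMixed Q = q • Q`. -/
def hessMixedCoeff (Q : ℂ → Mink) (z : ℂ) : ℝ := -minkForm (halfLaplacian Q z) (hessMixed Q z)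

namespace IsFlatNull

variable {Q : ℂ → Mink} (h : IsFlatNull Q)
include h

theorem smooth_d (a : ℂ) : ContDiff ℝ ∞ (planeDeriv a Q) := contDiff_planeDeriv h.smooth a

theorem smooth_dd (a b : ℂ) : ContDiff ℝ ∞ (planeDeriv a (planeDeriv b Q)) :=
  contDiff_planeDeriv (h.smooth_d b) a

theorem mixed_eq : planeDeriv 1 (planeDeriv I Q) = hessMixed Q := planeDeriv_comm h.smooth 1 I

theorem self_d (a z : ℂ) : minkForm (Q z) (planeDeriv a Q z) = 0 := by
  have := planeDeriv_minkForm_eq_zero h.smooth h.smooth h.null a z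
  rw [minkForm_comm (planeDeriv a Q z)] at this
  linarith

/-- Differentiate the orthogonality of Q to its first derivatives. With the relations that follow,
which say that the Christoffel symbols vanish, this makes Q, Q_x, Q_y and half the Laplacian a null
frame. -/
theorem self_dd (a b z : ℂ) : minkForm (Q z) (planeDeriv a (planeDeriv b Q) z)
    = -minkForm (planeDeriv a Q z) (planeDeriv b Q z) := by
  have := planeDeriv_minkForm_eq_zero h.smooth (h.smooth_d b) (h.self_d b) a z
  linarith

theorem one_mixed (z : ℂ) : minkForm (planeDeriv 1 Q z) (hessMixed Q z) = 0 := by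
  have := planeDeriv_minkForm_eq_zero (h.smooth_d 1) (h.smooth_d 1) h.one_one I z
  rw [minkForm_comm (planeDeriv I _ z)] at this
  unfold hessMixed
  linarith

theorem one_oneone (z : ℂ) :
    minkForm (planeDeriv 1 Q z) (planeDeriv 1 (planeDeriv 1 Q) z) = 0 := by
  have := planeDeriv_minkForm_eq_zero (h.smooth_d 1) (h.smooth_d 1) h.one_one 1 z
  rw [minkForm_comm (planeDeriv 1 _ z)] at this
  linarith

theorem I_mixed (z : ℂ) : minkForm (planeDeriv I Q z) (hessMixed Q z) = 0 := by
  have := planeDeriv_minkForm_eq_zero (h.smooth_d I) (h.smooth_d I) h.I_I 1 z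
  rw [minkForm_comm (planeDeriv 1 _ z), h.mixed_eq] at this
  linarith

theorem I_II (z : ℂ) : minkForm (planeDeriv I Q z) (planeDeriv I (planeDeriv I Q) z) = 0 := by
  have := planeDeriv_minkForm_eq_zero (h.smooth_d I) (h.smooth_d I) h.I_I I z
  rw [minkForm_comm (planeDeriv I _ z)] at this
  linarith

theorem I_oneone (z : ℂ) : minkForm (planeDeriv I Q z) (planeDeriv 1 (planeDeriv 1 Q) z) = 0 := by
  have := planeDeriv_minkForm_eq_zero (h.smooth_d 1) (h.smooth_d I) h.one_I 1 z
  rw [h.mixed_eq, h.one_mixed, add_zero] at this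
  rw [minkForm_comm, this]

theorem one_II (z : ℂ) : minkForm (planeDeriv 1 Q z) (planeDeriv I (planeDeriv I Q) z) = 0 := by
  have := planeDeriv_minkForm_eq_zero (h.smooth_d 1) (h.smooth_d I) h.one_I I z
  have h2 := h.I_mixed z
  rw [minkForm_comm] at h2
  unfold hessMixed at h2
  linarith

theorem self_laplacian (z : ℂ) : minkForm (Q z) (halfLaplacian Q z) = -1 := by
  rw [halfLaplacian, minkForm_smul_right, minkForm_add_right, h.self_dd, h.self_dd, h.one_one,
    h.I_I]
  norm_num

theorem one_laplacian (z : ℂ) : minkForm (planeDeriv 1 Q z) (halfLaplacian Q z) = 0 := by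
  rw [halfLaplacian, minkForm_smul_right, minkForm_add_right, h.one_oneone, h.one_II]
  norm_num

theorem I_laplacian (z : ℂ) : minkForm (planeDeriv I Q z) (halfLaplacian Q z) = 0 := by
  rw [halfLaplacian, minkForm_smul_right, minkForm_add_right, h.I_oneone, h.I_II]
  norm_num

theorem eq_smul_self {X : Mink} {z : ℂ} (h0 : minkForm (Q z) X = 0)
    (h1 : minkForm (planeDeriv 1 Q z) X = 0) (h2 : minkForm (planeDeriv I Q z) X = 0) :
    X = (-minkForm (halfLaplacian Q z) X) • Q z :=
  eq_smul_of_orthogonal_frame (h.null z) (h.self_d 1 z) (h.self_d I z) (h.one_one z) (h.I_I z)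
    (h.one_I z) (h.self_laplacian z) (h.one_laplacian z) (h.I_laplacian z) h0 h1 h2

/-- The products of Q with Q_xx and Q_yy are both -1 and cancel, and second derivatives are
orthogonal to first ones; only a multiple of Q can remain. -/
theorem hessDiff_eq (z : ℂ) : hessDiff Q z = hessDiffCoeff Q z • Q z := by
  refine h.eq_smul_self ?_ ?_ ?_
  · rw [hessDiff, minkForm_sub_right, h.self_dd, h.self_dd, h.one_one, h.I_I, sub_self]
  · rw [hessDiff, minkForm_sub_right, h.one_oneone, h.one_II, sub_self]
  · rw [hessDiff, minkForm_sub_right, h.I_oneone, h.I_II, sub_self]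

theorem hessMixed_eq (z : ℂ) : hessMixed Q z = hessMixedCoeff Q z • Q z := by
  refine h.eq_smul_self ?_ (h.one_mixed z) (h.I_mixed z)
  rw [hessMixed, h.self_dd, minkForm_comm, h.one_I, neg_zero]

theorem third_oneoneI : planeDeriv I (planeDeriv 1 (planeDeriv 1 Q)) = planeDeriv 1 (hessMixed Q) :=
  planeDeriv_comm (h.smooth_d 1) I 1

theorem third_oneII : planeDeriv 1 (planeDeriv I (planeDeriv I Q)) = planeDeriv I (hessMixed Q) := by
  rw [planeDeriv_comm (h.smooth_d I) 1 I, h.mixed_eq]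

/-- The Gauss equation of a flat metric. -/
theorem oneone_II (z : ℂ) :
    minkForm (planeDeriv 1 (planeDeriv 1 Q) z) (planeDeriv I (planeDeriv I Q) z) = 0 := by
  have h1 := planeDeriv_minkForm_eq_zero (h.smooth_d I) (h.smooth_dd 1 1) h.I_oneone I z
  have h2 := planeDeriv_minkForm_eq_zero (h.smooth_d I) (h.smooth_dd I 1) h.I_mixed 1 z
  rw [h.third_oneoneI, minkForm_comm] at h1
  rw [h.mixed_eq] at h2
  have h3 : minkForm (hessMixed Q z) (hessMixed Q z) = 0 := by
    rw [h.hessMixed_eq z, minkForm_smul_left, minkForm_smul_right, h.null]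
    simp
  change minkForm (hessMixed Q z) (hessMixed Q z) + minkForm (planeDeriv I Q z)
    (planeDeriv 1 (hessMixed Q) z) = 0 at h2
  linarith

/-- The difference Q_xx - Q_yy is a multiple of Q, hence null, and Q_xx · Q_yy = 0 by the Gauss
equation; so the sum Q_xx + Q_yy is null too. -/
theorem laplacian_null (z : ℂ) : minkForm (halfLaplacian Q z) (halfLaplacian Q z) = 0 := by
  have h1 : minkForm (hessDiff Q z) (hessDiff Q z) = 0 := by
    rw [h.hessDiff_eq z, minkForm_smul_left, minkForm_smul_right, h.null]
    simp
  have h2 := h.oneone_II z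
  have h3 := h2
  rw [minkForm_comm] at h3
  simp only [hessDiff, minkForm_sub_left, minkForm_sub_right] at h1
  simp only [halfLaplacian, minkForm_smul_left, minkForm_smul_right, minkForm_add_left,
    minkForm_add_right]
  linarith

theorem smooth_laplacian : ContDiff ℝ ∞ (halfLaplacian Q) :=
  ((h.smooth_dd 1 1).add (h.smooth_dd I I)).const_smul (1 / 2 : ℝ)

theorem smooth_hessDiff : ContDiff ℝ ∞ (hessDiff Q) := (h.smooth_dd 1 1).sub (h.smooth_dd I I)

theorem smooth_hessDiffCoeff : ContDiff ℝ ∞ (hessDiffCoeff Q) :=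
  (contDiff_minkForm h.smooth_laplacian h.smooth_hessDiff).neg

theorem smooth_hessMixedCoeff : ContDiff ℝ ∞ (hessMixedCoeff Q) :=
  (contDiff_minkForm h.smooth_laplacian (h.smooth_dd I 1)).neg

theorem laplacian_d (a z : ℂ) :
    minkForm (planeDeriv a (halfLaplacian Q) z) (halfLaplacian Q z) = 0 := by
  have := planeDeriv_minkForm_eq_zero h.smooth_laplacian h.smooth_laplacian h.laplacian_null a z
  rw [minkForm_comm (halfLaplacian Q z)] at this
  linarith

theorem d_hessDiff_laplacian {a : ℂ} (z : ℂ)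
    (ha : minkForm (planeDeriv a Q z) (halfLaplacian Q z) = 0) :
    minkForm (planeDeriv a (hessDiff Q) z) (halfLaplacian Q z)
      = -planeDeriv a (hessDiffCoeff Q) z := by
  rw [funext h.hessDiff_eq, planeDeriv_smul (h.smooth_hessDiffCoeff.differentiableAt_infty z)
    (h.smooth.differentiableAt_infty z), minkForm_add_left, minkForm_smul_left, minkForm_smul_left,
    h.self_laplacian, ha]
  ring

theorem d_hessMixed_laplacian {a : ℂ} (z : ℂ)
    (ha : minkForm (planeDeriv a Q z) (halfLaplacian Q z) = 0) :
    minkForm (planeDeriv a (hessMixed Q) z) (halfLaplacian Q z)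
      = -planeDeriv a (hessMixedCoeff Q) z := by
  rw [funext h.hessMixed_eq, planeDeriv_smul (h.smooth_hessMixedCoeff.differentiableAt_infty z)
    (h.smooth.differentiableAt_infty z), minkForm_add_left, minkForm_smul_left, minkForm_smul_left,
    h.self_laplacian, ha]
  ring

/-- A Codazzi equation: write Q_xx = N + (p/2) Q in ∂_y Q_xx = ∂_x Q_xy and pair with N. The term
N_y · N vanishes because N is null, and N · Q = -1 isolates the derivatives of p and q. -/
theorem d_hessDiffCoeff_I (z : ℂ) :
    planeDeriv I (hessDiffCoeff Q) z = 2 * planeDeriv 1 (hessMixedCoeff Q) z := by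
  have h1 : planeDeriv 1 (planeDeriv 1 Q)
      = fun z => halfLaplacian Q z + (1 / 2 : ℝ) • hessDiff Q z := by
    funext z
    simp only [halfLaplacian, hessDiff]
    module
  have h2 := congrFun h.third_oneoneI z
  have hD := h.smooth_hessDiff.differentiableAt_infty z
  rw [h1, planeDeriv_add (h.smooth_laplacian.differentiableAt_infty z) (hD.fun_const_smul _),
    planeDeriv_smul (differentiableAt_const _) hD, planeDeriv_const, zero_smul, zero_add] at h2
  have h3 := congrArg (fun v => minkForm v (halfLaplacian Q z)) h2
  simp only [minkForm_add_left, minkForm_smul_left, h.laplacian_d,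
    h.d_hessDiff_laplacian z (h.I_laplacian z), h.d_hessMixed_laplacian z (h.one_laplacian z)] at h3
  linarith

theorem d_hessDiffCoeff_one (z : ℂ) :
    planeDeriv 1 (hessDiffCoeff Q) z = -2 * planeDeriv I (hessMixedCoeff Q) z := by
  have h1 : planeDeriv I (planeDeriv I Q)
      = fun z => halfLaplacian Q z - (1 / 2 : ℝ) • hessDiff Q z := by
    funext z
    simp only [halfLaplacian, hessDiff]
    module
  have h2 := congrFun h.third_oneII z
  have hD := h.smooth_hessDiff.differentiableAt_infty z
  rw [h1, planeDeriv_sub (h.smooth_laplacian.differentiableAt_infty z) (hD.fun_const_smul _),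
    planeDeriv_smul (differentiableAt_const _) hD, planeDeriv_const, zero_smul, zero_add] at h2
  have h3 := congrArg (fun v => minkForm v (halfLaplacian Q z)) h2
  simp only [minkForm_sub_left, minkForm_smul_left, h.laplacian_d,
    h.d_hessDiff_laplacian z (h.one_laplacian z), h.d_hessMixed_laplacian z (h.I_laplacian z)] at h3
  linarith

/-- The Schwarzian of a flat null immersion is holomorphic. -/
theorem differentiable_schwarzian : Differentiable ℂ fun z =>
    (hessDiffCoeff Q z : ℂ) - 2 * I * (hessMixedCoeff Q z : ℂ) := by
  intro z
  have hp := (h.smooth_hessDiffCoeff.differentiableAt_infty z).hasFDerivAt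
  have hq := (h.smooth_hessMixedCoeff.differentiableAt_infty z).hasFDerivAt
  have hS := (Complex.ofRealCLM.hasFDerivAt.comp z hp).sub
    ((Complex.ofRealCLM.hasFDerivAt.comp z hq).const_mul (2 * I))
  rw [differentiableAt_complex_iff_differentiableAt_real]
  refine ⟨hS.differentiableAt, ?_⟩
  -- The two Codazzi equations p_x = -2 q_y and p_y = 2 q_x are the Cauchy-Riemann equations of p -
  -- 2iq.
  have e1 := h.d_hessDiffCoeff_one z
  have e2 := h.d_hessDiffCoeff_I z
  unfold planeDeriv at e1 e2
  erw [hS.fderiv]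
  simp only [sub_apply, ContinuousLinearMap.comp_apply, smul_apply,
    Complex.ofRealCLM_apply, smul_eq_mul, e1, e2]
  push_cast
  ring_nf
  simp only [Complex.I_sq]
  ring

/-- A flat null immersion with vanishing Schwarzian is quadratic. -/
theorem eq_quadratic (hp : ∀ z, hessDiffCoeff Q z = 0) (hq : ∀ z, hessMixedCoeff Q z = 0) (z : ℂ) :
    Q z = Q 0 + z.re • planeDeriv 1 Q 0 + z.im • planeDeriv I Q 0
      + ((z.re ^ 2 + z.im ^ 2) / 2) • halfLaplacian Q 0 := by
  have hM : hessMixed Q = fun _ => 0 := funext fun z => by rw [h.hessMixed_eq, hq, zero_smul]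
  have hD : ∀ z, hessDiff Q z = 0 := fun z => by rw [h.hessDiff_eq, hp, zero_smul]
  have h11 : halfLaplacian Q = planeDeriv 1 (planeDeriv 1 Q) := funext fun z => by
    have := sub_eq_zero.1 (hD z)
    rw [halfLaplacian, ← this]
    module
  have hII : halfLaplacian Q = planeDeriv I (planeDeriv I Q) := funext fun z => by
    have := sub_eq_zero.1 (hD z)
    rw [halfLaplacian, this]
    module
  have hre : ∀ z a : ℂ, planeDeriv a (fun z : ℂ => z.re) z = a.re := fun z a => by
    unfold planeDeriv
    exact congrArg (fun T => T a) (Complex.reCLM.hasFDerivAt (x := z)).fderiv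
  have him : ∀ z a : ℂ, planeDeriv a (fun z : ℂ => z.im) z = a.im := fun z a => by
    unfold planeDeriv
    exact congrArg (fun T => T a) (Complex.imCLM.hasFDerivAt (x := z)).fderiv
  have dre : Differentiable ℝ fun z : ℂ => z.re := Complex.reCLM.differentiable
  have dim : Differentiable ℝ fun z : ℂ => z.im := Complex.imCLM.differentiable
  -- With p = q = 0 one has N = Q_xx = Q_yy and Q_xy = 0, so every derivative of N is a derivative
  -- of Q_xy. Integrating N twice then gives Q.
  have hN : halfLaplacian Q = fun _ => halfLaplacian Q 0 := by
    refine eq_of_planeDeriv_eq (h.smooth_laplacian.differentiable (by simp))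
      (differentiable_const _) (fun z => ?_) (fun z => ?_) rfl
    · rw [planeDeriv_const, hII, h.third_oneII, hM, planeDeriv_const]
    · rw [planeDeriv_const, h11, h.third_oneoneI, hM, planeDeriv_const]
  have hN' : ∀ z, halfLaplacian Q z = halfLaplacian Q 0 := congrFun hN
  set N := halfLaplacian Q 0
  have he : planeDeriv 1 Q = fun z => planeDeriv 1 Q 0 + z.re • N := by
    refine eq_of_planeDeriv_eq ((h.smooth_d 1).differentiable (by simp))
      (by fun_prop) (fun z => ?_) (fun z => ?_) (by simp)
    · rw [planeDeriv_add (by fun_prop) (by fun_prop), planeDeriv_smul (dre z) (by fun_prop),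
        planeDeriv_const, planeDeriv_const, hre, ← h11, hN']
      simp
    · rw [planeDeriv_add (by fun_prop) (by fun_prop), planeDeriv_smul (dre z) (by fun_prop),
        planeDeriv_const, planeDeriv_const, hre]
      change hessMixed Q z = _
      simp [hM]
  have hf : planeDeriv I Q = fun z => planeDeriv I Q 0 + z.im • N := by
    refine eq_of_planeDeriv_eq ((h.smooth_d I).differentiable (by simp))
      (by fun_prop) (fun z => ?_) (fun z => ?_) (by simp)
    · rw [planeDeriv_add (by fun_prop) (by fun_prop), planeDeriv_smul (dim z) (by fun_prop),
        planeDeriv_const, planeDeriv_const, him, h.mixed_eq]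
      simp [hM]
    · rw [planeDeriv_add (by fun_prop) (by fun_prop), planeDeriv_smul (dim z) (by fun_prop),
        planeDeriv_const, planeDeriv_const, him, ← hII, hN']
      simp
  have hsq : ∀ z a : ℂ, planeDeriv a (fun z : ℂ => (z.re ^ 2 + z.im ^ 2) / 2) z
      = z.re * a.re + z.im * a.im := fun z a => by
    have hr := Complex.reCLM.hasFDerivAt (x := z)
    have hi := Complex.imCLM.hasFDerivAt (x := z)
    have hs : HasFDerivAt (fun z : ℂ => (z.re * z.re + z.im * z.im) * (2 : ℝ)⁻¹) _ z :=
      ((hr.mul hr).add (hi.mul hi)).mul_const (2 : ℝ)⁻¹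
    simp only [pow_two, div_eq_mul_inv]
    refine (congrArg (fun T => T a) hs.fderiv).trans ?_
    simp
    ring
  have hQ : Q = fun z : ℂ => Q 0 + z.re • planeDeriv 1 Q 0 + z.im • planeDeriv I Q 0
      + ((z.re ^ 2 + z.im ^ 2) / 2) • N := by
    have key : ∀ a z : ℂ, planeDeriv a (fun z : ℂ => Q 0 + z.re • planeDeriv 1 Q 0
        + z.im • planeDeriv I Q 0 + ((z.re ^ 2 + z.im ^ 2) / 2) • N) z
        = a.re • planeDeriv 1 Q 0 + a.im • planeDeriv I Q 0 + (z.re * a.re + z.im * a.im) • N := by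
      intro a z
      rw [planeDeriv_add (by fun_prop) (by fun_prop), planeDeriv_add (by fun_prop) (by fun_prop),
        planeDeriv_add (by fun_prop) (by fun_prop), planeDeriv_smul (by fun_prop) (by fun_prop),
        planeDeriv_smul (by fun_prop) (by fun_prop), planeDeriv_smul (by fun_prop) (by fun_prop),
        hre, him, hsq]
      simp only [planeDeriv_const, smul_zero, add_zero, zero_add]
    refine eq_of_planeDeriv_eq (h.smooth.differentiable (by simp)) (by fun_prop)
      (fun z => ?_) (fun z => ?_) (by simp)
    · rw [key, he]; simp
    · rw [key, hf]; simp
  exact congrFun hQ z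

end IsFlatNull

end NullImmersion

/-! ### The parabolic section of the cone -/

section Stereographic

open Complex (I)

/-- A homogeneous parametrization of the light cone by the plane: `x / ‖x‖` is the inverse
stereographic projection. -/
def parabolicChart (z : ℂ) : Space3 := !₂[z.re, z.im, (z.re ^ 2 + z.im ^ 2 - 1) / 2]

/-- The derivative of `parabolicChart` at `z` in the direction `a`. -/
def parabolicTangent (a z : ℂ) : Space3 := !₂[a.re, a.im, z.re * a.re + z.im * a.im]

theorem norm_parabolicChart (z : ℂ) : ‖parabolicChart z‖ = (1 + (z.re ^ 2 + z.im ^ 2)) / 2 := by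
  rw [← sq_eq_sq₀ (norm_nonneg _) (by positivity), norm_sq_space3]
  simp [parabolicChart]
  ring

theorem parabolicChart_ne_zero (z : ℂ) : parabolicChart z ≠ 0 := by
  rw [← norm_ne_zero_iff, norm_parabolicChart]
  positivity

theorem contDiff_parabolicChart : ContDiff ℝ ∞ parabolicChart := by
  rw [contDiff_euclidean]
  intro i
  have hr : ContDiff ℝ ∞ fun z : ℂ => z.re := Complex.reCLM.contDiff
  have hi : ContDiff ℝ ∞ fun z : ℂ => z.im := Complex.imCLM.contDiff
  fin_cases i
  · exact hr
  · exact hi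
  · exact ((((hr.pow 2).add (hi.pow 2)).sub contDiff_const).div_const 2)

theorem planeDeriv_parabolicChart (a z : ℂ) :
    planeDeriv a parabolicChart z = parabolicTangent a z := by
  have hd : DifferentiableAt ℝ parabolicChart z := contDiff_parabolicChart.differentiableAt_infty z
  have hr := Complex.reCLM.hasFDerivAt (x := z)
  have hi := Complex.imCLM.hasFDerivAt (x := z)
  have hs : HasFDerivAt (fun z : ℂ => (z.re * z.re + z.im * z.im - 1) * (2 : ℝ)⁻¹) _ z :=
    (((hr.mul hr).add (hi.mul hi)).sub_const 1).mul_const (2 : ℝ)⁻¹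
  have key : ∀ i, (planeDeriv a parabolicChart z) i
      = fderiv ℝ (fun z => parabolicChart z i) z a := fun i => by
    have h2 := ((EuclideanSpace.proj (𝕜 := ℝ) i : Space3 →L[ℝ] ℝ).hasFDerivAt.comp z
      hd.hasFDerivAt).fderiv
    exact (congrArg (fun T => T a) h2).symm
  apply space3_ext
  · rw [key]
    exact congrArg (fun T => T a) hr.fderiv
  · rw [key]
    exact congrArg (fun T => T a) hi.fderiv
  · rw [key]
    have e : (fun z => parabolicChart z 2)
        = fun z : ℂ => (z.re * z.re + z.im * z.im - 1) * (2 : ℝ)⁻¹ := by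
      funext z
      simp [parabolicChart, pow_two, div_eq_mul_inv]
    rw [e, hs.fderiv]
    simp [parabolicTangent]
    ring

theorem hasFDerivAt_parabolicTangent (b z : ℂ) :
    HasFDerivAt (parabolicTangent b)
      ((b.re • Complex.reCLM + b.im • Complex.imCLM).smulRight (!₂[0, 0, 1] : Space3)) z := by
  have e : parabolicTangent b = fun z => (!₂[b.re, b.im, 0] : Space3)
      + (b.re • Complex.reCLM + b.im • Complex.imCLM).smulRight (!₂[0, 0, 1] : Space3) z := by
    funext z
    apply space3_ext <;> simp [parabolicTangent]
    ring
  rw [e]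
  exact (ContinuousLinearMap.hasFDerivAt _).const_add _

theorem norm_parabolicTangent_sq {a z : ℂ} (ha : a = 1 ∨ a = I) :
    ‖parabolicTangent a z‖ ^ 2 ≤ 2 * ‖parabolicChart z‖ := by
  rw [norm_parabolicChart, norm_sq_space3]
  rcases ha with rfl | rfl <;> simp [parabolicTangent] <;> nlinarith [sq_nonneg z.re, sq_nonneg z.im]

theorem inner_angular_parabolicChart (a z : ℂ) :
    inner ℝ (angular (parabolicChart z)) (parabolicTangent a z) = z.re * a.re + z.im * a.im := by
  have h : (1 + (z.re ^ 2 + z.im ^ 2)) / 2 ≠ 0 := by positivity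
  rw [angular, real_inner_smul_left, norm_parabolicChart, inv_mul_eq_iff_eq_mul₀ h, inner_space3]
  simp [parabolicChart, parabolicTangent]
  ring

theorem abs_le_norm_parabolicChart (z : ℂ) : ‖z‖ ≤ ‖parabolicChart z‖ := by
  rw [norm_parabolicChart]
  have h : ‖z‖ ^ 2 = z.re ^ 2 + z.im ^ 2 := by
    rw [← Complex.normSq_eq_norm_sq, Complex.normSq_apply]; ring
  nlinarith [sq_nonneg (‖z‖ - 1)]

/-- Scaling a null vector to the section t - x₂ = 1. Only the ray along the positive third axis is
missed. -/
theorem eq_smul_parabolicChart {x : Space3} (hx : 0 < ‖x‖ - x 2) :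
    x = (‖x‖ - x 2) • parabolicChart ⟨x 0 / (‖x‖ - x 2), x 1 / (‖x‖ - x 2)⟩ := by
  have h := norm_sq_space3 x
  apply space3_ext
  · simp [parabolicChart]; field_simp
  · simp [parabolicChart]; field_simp
  · simp [parabolicChart]; field_simp; linarith

end Stereographic

/-! ### Homogeneous isometries of the cone and Liouville's theorem -/

section Homogeneous

theorem exists_pos_le_norm_sphere {E : Type*} [NormedAddCommGroup E] {F : Space3 → E}
    (hF : ContinuousOn F {0}ᶜ) (h0 : ∀ x, x ≠ 0 → F x ≠ 0) :
    ∃ c, 0 < c ∧ ∀ x : Space3, ‖x‖ = 1 → c ≤ ‖F x‖ := by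
  have hsub : Metric.sphere (0 : Space3) 1 ⊆ {0}ᶜ := fun x hx h => by
    rw [Set.mem_singleton_iff.1 h] at hx; simp at hx
  obtain ⟨x₀, hx₀, hmin⟩ := (isCompact_sphere (0 : Space3) 1).exists_isMinOn
    (NormedSpace.sphere_nonempty.2 zero_le_one) (hF.norm.mono hsub)
  exact ⟨‖F x₀‖, norm_pos_iff.2 (h0 x₀ (hsub hx₀)), fun x hx => hmin (by simpa using hx)⟩

theorem exists_norm_le_sphere {E : Type*} [NormedAddCommGroup E] {F : Space3 → E}
    (hF : ContinuousOn F {0}ᶜ) : ∃ C, 0 ≤ C ∧ ∀ x : Space3, ‖x‖ = 1 → ‖F x‖ ≤ C := by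
  have hsub : Metric.sphere (0 : Space3) 1 ⊆ {0}ᶜ := fun x hx h => by
    rw [Set.mem_singleton_iff.1 h] at hx; simp at hx
  obtain ⟨C, hC⟩ := (isCompact_sphere (0 : Space3) 1).exists_bound_of_continuousOn (hF.mono hsub)
  exact ⟨max C 0, le_max_right _ _, fun x hx => (hC x (by simpa using hx)).trans (le_max_left _ _)⟩

theorem exists_norm_le_div_norm {E : Type*} [NormedAddCommGroup E] [NormedSpace ℝ E]
    {F : Space3 → E} (hF : ContinuousOn F {0}ᶜ)
    (hhom : ∀ c : ℝ, 0 < c → ∀ x, c • F (c • x) = F x) :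
    ∃ C, 0 ≤ C ∧ ∀ x, x ≠ 0 → ‖F x‖ ≤ C / ‖x‖ := by
  obtain ⟨C, hC, hb⟩ := exists_norm_le_sphere hF
  refine ⟨C, hC, fun x hx => ?_⟩
  have hn := norm_pos_iff.2 hx
  have h1 := hhom _ hn (angular x)
  rw [norm_smul_angular] at h1
  rw [le_div_iff₀ hn]
  calc ‖F x‖ * ‖x‖ = ‖‖x‖ • F x‖ := by rw [norm_smul, norm_norm, mul_comm]
    _ ≤ C := by rw [h1]; exact hb _ (norm_angular hx)

/-- Maps of the cone into itself, given in the coordinate `x`, which are homogeneous and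
isometric for the degenerate form. -/
structure IsConeIsometry (H : Space3 → Mink) : Prop where
  smooth : ContDiffOn ℝ ∞ H {0}ᶜ
  homogeneous : ∀ c : ℝ, 0 < c → ∀ x, H (c • x) = c • H x
  ne_zero : ∀ x, x ≠ 0 → H x ≠ 0
  null : ∀ x, x ≠ 0 → minkForm (H x) (H x) = 0
  isometric : ∀ x, x ≠ 0 → ∀ v, minkForm (fderiv ℝ H x v) (fderiv ℝ H x v)
    = ‖v‖ ^ 2 - inner ℝ (angular x) v ^ 2

namespace IsConeIsometry

open Complex (I)

variable {H : Space3 → Mink} (h : IsConeIsometry H)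
include h

theorem contDiffAt {x : Space3} (hx : x ≠ 0) : ContDiffAt ℝ ∞ H x :=
  h.smooth.contDiffAt (isOpen_compl_singleton.mem_nhds hx)

theorem isometric₂ {x : Space3} (hx : x ≠ 0) (v w : Space3) :
    minkForm (fderiv ℝ H x v) (fderiv ℝ H x w)
      = inner ℝ v w - inner ℝ (angular x) v * inner ℝ (angular x) w := by
  have h1 := h.isometric x hx (v + w)
  rw [map_add, minkForm_add_left, minkForm_add_right, minkForm_add_right, h.isometric x hx v,
    h.isometric x hx w, minkForm_comm (fderiv ℝ H x w), inner_add_right, @norm_add_sq ℝ] at h1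
  simp only [RCLike.re_to_real] at h1
  linarith

theorem fderiv_smul {c : ℝ} (hc : 0 < c) (x : Space3) : fderiv ℝ H (c • x) = fderiv ℝ H x := by
  have h1 : (fun y => H (c • y)) = fun y => c • H y := funext (h.homogeneous c hc)
  have h2 := fderiv_comp_smul (𝕜 := ℝ) (f := H) (x := x) c
  have h3 : fderiv ℝ (fun y => c • H y) x = c • fderiv ℝ H x :=
    congrFun (fderiv_const_smul_field (𝕜 := ℝ) (f := H) c) x
  rw [h1, h3] at h2
  exact (smul_right_injective _ hc.ne' h2).symm

theorem fderiv_fderiv_smul {c : ℝ} (hc : 0 < c) (x : Space3) :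
    c • fderiv ℝ (fderiv ℝ H) (c • x) = fderiv ℝ (fderiv ℝ H) x := by
  have h1 : (fun y => fderiv ℝ H (c • y)) = fderiv ℝ H := funext (h.fderiv_smul hc)
  have h2 := fderiv_comp_smul (𝕜 := ℝ) (f := fderiv ℝ H) (x := x) c
  rw [h1] at h2
  exact h2.symm

theorem contDiffOn_fderiv : ContDiffOn ℝ ∞ (fderiv ℝ H) {0}ᶜ :=
  h.smooth.fderiv_of_isOpen isOpen_compl_singleton (by simp)

theorem exists_lower_bound : ∃ c, 0 < c ∧ ∀ x, x ≠ 0 → c * ‖x‖ ≤ ‖H x‖ := by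
  obtain ⟨c, hc, hb⟩ := exists_pos_le_norm_sphere h.smooth.continuousOn h.ne_zero
  refine ⟨c, hc, fun x hx => ?_⟩
  have hn := norm_pos_iff.2 hx
  conv_rhs => rw [← norm_smul_angular x, h.homogeneous _ hn, norm_smul, norm_norm, mul_comm]
  exact mul_le_mul_of_nonneg_right (hb _ (norm_angular hx)) hn.le

theorem exists_bound_second : ∃ C, 0 ≤ C ∧ ∀ x, x ≠ 0 → ‖fderiv ℝ (fderiv ℝ H) x‖ ≤ C / ‖x‖ := by
  have hc : ContinuousOn (fderiv ℝ (fderiv ℝ H)) {0}ᶜ :=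
    (h.contDiffOn_fderiv.fderiv_of_isOpen (m := ∞) isOpen_compl_singleton (by simp)).continuousOn
  exact exists_norm_le_div_norm (E := Space3 →L[ℝ] Space3 →L[ℝ] Mink) hc
    fun _ hc x => h.fderiv_fderiv_smul hc x

theorem planeDeriv_comp (a z : ℂ) : planeDeriv a (H ∘ parabolicChart) z
    = fderiv ℝ H (parabolicChart z) (parabolicTangent a z) := by
  have hd := (h.contDiffAt (parabolicChart_ne_zero z)).differentiableAt (by simp)
  rw [← planeDeriv_parabolicChart]
  exact congrArg (fun T => T a) (hd.hasFDerivAt.comp z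
    (contDiff_parabolicChart.differentiableAt_infty z).hasFDerivAt).fderiv

theorem planeDeriv_planeDeriv_comp (a b z : ℂ) :
    planeDeriv a (planeDeriv b (H ∘ parabolicChart)) z
    = fderiv ℝ (fderiv ℝ H) (parabolicChart z) (parabolicTangent a z) (parabolicTangent b z)
      + (b.re * a.re + b.im * a.im) • fderiv ℝ H (parabolicChart z) !₂[0, 0, 1] := by
  have h0 := parabolicChart_ne_zero z
  have hd : DifferentiableAt ℝ (fderiv ℝ H) (parabolicChart z) :=
    (h.contDiffOn_fderiv.contDiffAt (isOpen_compl_singleton.mem_nhds h0)).differentiableAt (by simp)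
  have h1 := (hd.hasFDerivAt.comp z
    (contDiff_parabolicChart.differentiableAt_infty z).hasFDerivAt).clm_apply
      (hasFDerivAt_parabolicTangent b z)
  rw [funext (h.planeDeriv_comp b)]
  refine (congrArg (fun T => T a) h1.fderiv).trans ?_
  rw [← planeDeriv_parabolicChart a z]
  simp [planeDeriv, add_comm]

/-- In the parabolic section the radial part removed from |v|² is exactly the square of the third
component of the tangent vector, so the degenerate form becomes |dz|². -/
theorem isFlatNull : IsFlatNull (H ∘ parabolicChart) where
  smooth := h.smooth.comp_contDiff contDiff_parabolicChart parabolicChart_ne_zero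
  null z := h.null _ (parabolicChart_ne_zero z)
  one_one z := by
    rw [h.planeDeriv_comp, h.isometric₂ (parabolicChart_ne_zero z), inner_angular_parabolicChart,
      inner_space3]
    simp [parabolicTangent]
  I_I z := by
    rw [h.planeDeriv_comp, h.isometric₂ (parabolicChart_ne_zero z), inner_angular_parabolicChart,
      inner_space3]
    simp [parabolicTangent]
  one_I z := by
    rw [h.planeDeriv_comp, h.planeDeriv_comp, h.isometric₂ (parabolicChart_ne_zero z),
      inner_angular_parabolicChart, inner_angular_parabolicChart, inner_space3]
    simp [parabolicTangent]

/-- Smoothness of H on the entire sphere, including the point at infinity of the chart, enters here.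
Since D²H is homogeneous of degree -1 and the chart tangents have squared length at most 2‖chart‖, p
Q and q Q are bounded, while ‖Q‖ grows at least like ‖chart‖. -/
theorem exists_schwarzian_bound : ∃ K : ℝ, ∀ z : ℂ,
    ‖(hessDiffCoeff (H ∘ parabolicChart) z : ℂ)
      - 2 * I * (hessMixedCoeff (H ∘ parabolicChart) z : ℂ)‖ ≤ K / ‖parabolicChart z‖ := by
  obtain ⟨c, hc, hlow⟩ := h.exists_lower_bound
  obtain ⟨C, hC, hup⟩ := h.exists_bound_second
  have hF := h.isFlatNull
  refine ⟨8 * C / c, fun z => ?_⟩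
  have h0 := parabolicChart_ne_zero z
  have hn := norm_pos_iff.2 h0
  have hsecond : ∀ a b : ℂ, (a = 1 ∨ a = I) → (b = 1 ∨ b = I) →
      ‖fderiv ℝ (fderiv ℝ H) (parabolicChart z) (parabolicTangent a z) (parabolicTangent b z)‖
        ≤ 2 * C := by
    intro a b ha hb
    have ha' := norm_parabolicTangent_sq (z := z) ha
    have hb' := norm_parabolicTangent_sq (z := z) hb
    have hab : ‖parabolicTangent a z‖ * ‖parabolicTangent b z‖ ≤ 2 * ‖parabolicChart z‖ := by
      nlinarith [sq_nonneg (‖parabolicTangent a z‖ - ‖parabolicTangent b z‖)]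
    refine (ContinuousLinearMap.le_opNorm₂ _ _ _).trans ?_
    calc _ = ‖fderiv ℝ (fderiv ℝ H) (parabolicChart z)‖
          * (‖parabolicTangent a z‖ * ‖parabolicTangent b z‖) := by ring
      _ ≤ C / ‖parabolicChart z‖ * (2 * ‖parabolicChart z‖) :=
        mul_le_mul (hup _ h0) hab (by positivity) (by positivity)
      _ = 2 * C := by field_simp
  have hD : ‖hessDiff (H ∘ parabolicChart) z‖ ≤ 4 * C := by
    rw [hessDiff, h.planeDeriv_planeDeriv_comp, h.planeDeriv_planeDeriv_comp]
    -- The first-order terms, coming from the second derivative of the chart, are equal for Q_xx and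
    -- Q_yy and cancel; for Q_xy there is none.
    simp only [Complex.one_re, Complex.one_im, Complex.I_re, Complex.I_im, mul_one, mul_zero,
      add_zero, zero_add, add_sub_add_right_eq_sub]
    refine (norm_sub_le _ _).trans ?_
    linarith [hsecond 1 1 (.inl rfl) (.inl rfl), hsecond I I (.inr rfl) (.inr rfl)]
  have hM : ‖hessMixed (H ∘ parabolicChart) z‖ ≤ 2 * C := by
    rw [hessMixed, h.planeDeriv_planeDeriv_comp]
    simpa using hsecond I 1 (.inr rfl) (.inl rfl)
  rw [hF.hessDiff_eq, norm_smul, Real.norm_eq_abs] at hD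
  rw [hF.hessMixed_eq, norm_smul, Real.norm_eq_abs] at hM
  have hl := hlow _ h0
  have hD' := (mul_le_mul_of_nonneg_left hl (abs_nonneg _)).trans hD
  have hM' := (mul_le_mul_of_nonneg_left hl (abs_nonneg _)).trans hM
  refine (norm_sub_le _ _).trans ?_
  rw [norm_mul, norm_mul, Complex.norm_I, Complex.norm_real, Complex.norm_real, Real.norm_eq_abs,
    Real.norm_eq_abs, le_div_iff₀ hn, le_div_iff₀ hc]
  simp only [Complex.norm_ofNat, mul_one]
  nlinarith

/-- An entire function tending to 0 at infinity vanishes; p and q are read off from its real and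
imaginary parts. -/
theorem schwarzian_eq_zero (z : ℂ) : hessDiffCoeff (H ∘ parabolicChart) z = 0 ∧
    hessMixedCoeff (H ∘ parabolicChart) z = 0 := by
  obtain ⟨K, hK⟩ := h.exists_schwarzian_bound
  have hK0 : 0 ≤ K := by
    have := (norm_nonneg _).trans (hK 0)
    exact (div_nonneg_iff.1 this).elim And.left fun h =>
      absurd h.2 (not_le.2 (norm_pos_iff.2 (parabolicChart_ne_zero 0)))
  have ht : Filter.Tendsto (fun z => (hessDiffCoeff (H ∘ parabolicChart) z : ℂ)
      - 2 * I * (hessMixedCoeff (H ∘ parabolicChart) z : ℂ)) (Filter.cocompact ℂ) (nhds 0) := by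
    refine squeeze_zero_norm hK ?_
    refine Filter.Tendsto.div_atTop tendsto_const_nhds ?_
    exact Filter.tendsto_atTop_mono abs_le_norm_parabolicChart (tendsto_norm_cocompact_atTop)
  have := h.isFlatNull.differentiable_schwarzian.apply_eq_of_tendsto_cocompact z ht
  have h1 := congrArg Complex.re this
  have h2 := congrArg Complex.im this
  simp at h1 h2
  exact ⟨h1, h2⟩

/-- **Liouville's theorem** for the light cone: isometries of the degenerate form are restrictions
of linear isometries of Minkowski space. -/
theorem exists_linear : ∃ M : Mink →ₗ[ℝ] Mink, IsMinkIsometry M ∧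
    ∀ x, x ≠ 0 → H x = M (x, ‖x‖) := by
  set Q := H ∘ parabolicChart with hQdef
  have hF : IsFlatNull Q := h.isFlatNull
  have hquad := hF.eq_quadratic (fun z => (h.schwarzian_eq_zero z).1)
    (fun z => (h.schwarzian_eq_zero z).2)
  set e := planeDeriv 1 Q 0
  set f := planeDeriv I Q 0
  set N := halfLaplacian Q 0
  let φ : Mink →ₗ[ℝ] ℝ := LinearMap.snd ℝ Space3 ℝ
  let ψ (i : Fin 3) : Mink →ₗ[ℝ] ℝ :=
    (EuclideanSpace.proj (𝕜 := ℝ) i : Space3 →L[ℝ] ℝ).toLinearMap ∘ₗ LinearMap.fst ℝ Space3 ℝ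
  -- Homogenize the quadratic polynomial: with λ = t - x₂ and λz = (x₀, x₁), the null condition
  -- turns λ|z|²/2 into (t + x₂)/2.
  let M : Mink →ₗ[ℝ] Mink := (φ - ψ 2).smulRight (Q 0) + (ψ 0).smulRight e + (ψ 1).smulRight f
    + ((1 / 2 : ℝ) • (φ + ψ 2)).smulRight N
  have hM : ∀ p : Mink, M p = (p.2 - p.1 2) • Q 0 + p.1 0 • e + p.1 1 • f
      + ((1 / 2 : ℝ) * (p.2 + p.1 2)) • N := fun p => rfl
  have hiso : IsMinkIsometry M := by
    intro p q
    have g1 := hF.null 0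
    have g2 : minkForm (Q 0) e = 0 := hF.self_d 1 0
    have g3 : minkForm (Q 0) f = 0 := hF.self_d I 0
    have g4 : minkForm (Q 0) N = -1 := hF.self_laplacian 0
    have g5 : minkForm e e = 1 := hF.one_one 0
    have g6 : minkForm e f = 0 := hF.one_I 0
    have g7 : minkForm e N = 0 := hF.one_laplacian 0
    have g8 : minkForm f f = 1 := hF.I_I 0
    have g9 : minkForm f N = 0 := hF.I_laplacian 0
    have g10 : minkForm N N = 0 := hF.laplacian_null 0
    simp only [hM, minkForm_add_left, minkForm_add_right, minkForm_smul_left, minkForm_smul_right,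
      g1, g2, g3, g4, g5, g6, g7, g8, g9, g10, minkForm_comm e (Q 0), minkForm_comm f (Q 0),
      minkForm_comm N (Q 0), minkForm_comm f e, minkForm_comm N e, minkForm_comm N f]
    rw [minkForm, inner_space3]
    ring
  have hgen : ∀ x : Space3, 0 < ‖x‖ - x 2 → H x = M (x, ‖x‖) := by
    intro x hx
    set z : ℂ := ⟨x 0 / (‖x‖ - x 2), x 1 / (‖x‖ - x 2)⟩ with hz
    have hxz := eq_smul_parabolicChart hx
    have h1 : H x = (‖x‖ - x 2) • Q z := by
      conv_lhs => rw [hxz]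
      exact h.homogeneous _ hx _
    have h2 : ((x, ‖x‖) : Mink) = (‖x‖ - x 2) • (parabolicChart z, ‖parabolicChart z‖) := by
      refine Prod.ext hxz ?_
      conv_lhs => rw [hxz]
      simp [norm_smul, abs_of_pos hx, hz]
    rw [h1, h2, map_smul, hquad z, hM, norm_parabolicChart]
    congr 1
    simp only [parabolicChart]
    simp
    ring_nf
    simp
  refine ⟨M, hiso, fun x hx => ?_⟩
  by_cases hpos : 0 < ‖x‖ - x 2
  · exact hgen x hpos
  have hx2 : x 2 = ‖x‖ := by
    have : |x 2| ≤ ‖x‖ := by simpa using PiLp.norm_apply_le x 2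
    linarith [(abs_le.1 this).2]
  have hx0 : x 0 = 0 := by
    have := norm_sq_space3 x
    rw [hx2] at this
    nlinarith [sq_nonneg (x 0), sq_nonneg (x 1)]
  -- The remaining ray is reached by continuity, along a line that leaves it transversally.
  let γ : ℝ → Space3 := fun s => x + s • !₂[1, 0, 0]
  have hγ : Continuous γ := by fun_prop
  have hγ0 : γ 0 = x := by simp [γ]
  have hγpos : ∀ s : ℝ, s ≠ 0 → 0 < ‖γ s‖ - γ s 2 := by
    intro s hs
    have h1 := norm_sq_space3 (γ s)
    have h2 := norm_sq_space3 x
    have h3 : γ s 2 = x 2 := by simp [γ]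
    have h4 : γ s 0 = s := by simp [γ, hx0]
    have h5 : γ s 1 = x 1 := by simp [γ]
    rw [h3, h4, h5] at h1
    rw [hx0] at h2
    have h6 : ‖x‖ < ‖γ s‖ := by
      rw [← sq_lt_sq₀ (norm_nonneg _) (norm_nonneg _), h1, h2]
      nlinarith [sq_pos_of_ne_zero hs]
    rw [h3, hx2]
    linarith
  have hl : Filter.Tendsto (fun s => H (γ s)) (nhdsWithin 0 {0}ᶜ) (nhds (H x)) := by
    have h1 : ContinuousAt H (γ 0) := by rw [hγ0]; exact (h.contDiffAt hx).continuousAt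
    have h2 : ContinuousAt (fun s => H (γ s)) 0 := h1.comp hγ.continuousAt
    have h3 := h2.tendsto
    rw [hγ0] at h3
    exact h3.mono_left nhdsWithin_le_nhds
  have hr : Filter.Tendsto (fun s => M (γ s, ‖γ s‖)) (nhdsWithin 0 {0}ᶜ)
      (nhds (M (x, ‖x‖))) := by
    have h1 : Continuous fun s => M (γ s, ‖γ s‖) :=
      M.continuous_of_finiteDimensional.comp (hγ.prodMk hγ.norm)
    have h3 := h1.tendsto 0
    simp only [hγ0] at h3
    exact h3.mono_left nhdsWithin_le_nhds
  refine tendsto_nhds_unique (hl.congr' ?_) hr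
  filter_upwards [self_mem_nhdsWithin] with s hs
  exact hgen _ (hγpos s hs)

end IsConeIsometry

end Homogeneous

/-! ### Lorentz frames as solutions of a linear equation -/

section LorentzFrames

/-- Take determinants in Lᵀ J L = J, where J is the Gram matrix diag(1, 1, 1, -1). -/
theorem IsMinkIsometry.det_sq {L : Mink →ₗ[ℝ] Mink} (hL : IsMinkIsometry L) :
    LinearMap.det L ^ 2 = 1 := by
  let B : LinearMap.BilinForm ℝ Mink := LinearMap.mk₂ ℝ minkForm minkForm_add_left
    minkForm_smul_left minkForm_add_right minkForm_smul_right
  have hB : B.comp L L = B := LinearMap.ext₂ hL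
  have h1 := congrArg Matrix.det (LinearMap.BilinForm.toMatrix_comp minkBasis minkBasis B L L)
  rw [hB, Matrix.det_mul, Matrix.det_mul, Matrix.det_transpose, LinearMap.det_toMatrix] at h1
  have hJ : LinearMap.BilinForm.toMatrix minkBasis B = Matrix.diagonal ![1, 1, 1, -1] := by
    ext i j
    have hb : ∀ i, minkBasis i = minkEquivFun.symm (Pi.single i 1) := fun i => by
      simp [minkBasis]
    rw [LinearMap.BilinForm.toMatrix_apply, hb, hb]
    change minkForm _ _ = _
    rw [minkForm, inner_space3]
    fin_cases i <;> fin_cases j <;> simp [minkEquivFun]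
  have hdet : (LinearMap.BilinForm.toMatrix minkBasis B).det = -1 := by
    rw [hJ, Matrix.det_diagonal]
    simp [Fin.prod_univ_four]
  rw [hdet] at h1
  linarith

/-- The infinitesimal Lorentz transformation with boost `c.2` and rotation `c.1`. -/
def lorentzGen : Space3 × Space3 →L[ℝ] Mink →L[ℝ] Mink :=
  LinearMap.toContinuousLinearMap <|
    (LinearMap.toContinuousLinearMap (𝕜 := ℝ) (E := Mink) (F' := Mink)).toLinearMap ∘ₗ
      LinearMap.mk₂ ℝ (fun (c : Space3 × Space3) (p : Mink) =>
          ((p.2 • c.2 + cross3 p.1 c.1, inner ℝ p.1 c.2) : Mink))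
        (fun c c' p => by
          refine Prod.ext (space3_ext ?_ ?_ ?_) (inner_add_right _ _ _) <;> simp <;> ring)
        (fun a c p => by
          refine Prod.ext (space3_ext ?_ ?_ ?_) (real_inner_smul_right _ _ _) <;> simp <;> ring)
        (fun c p p' => by
          refine Prod.ext (space3_ext ?_ ?_ ?_) (inner_add_left _ _ _) <;> simp <;> ring)
        (fun a c p => by
          refine Prod.ext (space3_ext ?_ ?_ ?_) (real_inner_smul_left _ _ _) <;> simp <;> ring)

theorem lorentzGen_apply (s t : Space3) (p : Mink) :
    lorentzGen (s, t) p = (p.2 • t + cross3 p.1 s, inner ℝ p.1 t) := rfl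

theorem minkForm_lorentzGen (c : Space3 × Space3) (p q : Mink) :
    minkForm (lorentzGen c p) q + minkForm p (lorentzGen c q) = 0 := by
  obtain ⟨s, t⟩ := c
  simp only [lorentzGen_apply, minkForm, inner_add_left, inner_add_right, real_inner_smul_left,
    real_inner_smul_right, inner_cross3_comm p.1, real_inner_comm t]
  ring

theorem eq_at_one_of_hasDerivAt_zero {E : Type*} [NormedAddCommGroup E] [NormedSpace ℝ E] {f : ℝ → E}
    (h : ∀ r, 0 < r → HasDerivAt f 0 r) {r : ℝ} (hr : 0 < r) : f r = f 1 :=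
  isOpen_Ioi.is_const_of_deriv_eq_zero isPreconnected_Ioi
    (fun x hx => (h x hx).differentiableAt.differentiableWithinAt) (fun x hx => (h x hx).deriv)
    (Set.mem_Ioi.2 hr) (Set.mem_Ioi.2 one_pos)

theorem pos_of_continuousOn_ne_zero {f : ℝ → ℝ} (hf : ContinuousOn f (Set.Ioi 0))
    (h0 : ∀ r, 0 < r → f r ≠ 0) (h1 : 0 < f 1) {r : ℝ} (hr : 0 < r) : 0 < f r := by
  by_contra! hneg
  obtain ⟨s, hs, hs0⟩ := isPreconnected_Ioi.intermediate_value (Set.mem_Ioi.2 hr)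
    (Set.mem_Ioi.2 one_pos) hf ⟨hneg, h1.le⟩
  exact h0 s hs hs0

/-- A smooth family `L` of Lorentz transformations, with inverses `K`, rotating with angular
velocity `(s, t)`. -/
structure IsLorentzFrame (s t : ℝ → Space3) (L K : ℝ → Mink →L[ℝ] Mink) : Prop where
  smooth : ContDiffOn ℝ ∞ L (Set.Ioi 0)
  one : L 1 = ContinuousLinearMap.id ℝ Mink
  inv_one : K 1 = ContinuousLinearMap.id ℝ Mink
  hasDerivAt : ∀ r, 0 < r → HasDerivAt L (L r ∘L lorentzGen (s r, t r)) r
  hasDerivAt_inv : ∀ r, 0 < r → HasDerivAt K (-(lorentzGen (s r, t r) ∘L K r)) r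

theorem exists_lorentzFrame {s t : ℝ → Space3} (hs : ContDiffOn ℝ ∞ s (Set.Ioi 0))
    (ht : ContDiffOn ℝ ∞ t (Set.Ioi 0)) : ∃ L K, IsLorentzFrame s t L K := by
  have hA : ContDiffOn ℝ ∞ (fun r => lorentzGen (s r, t r)) (Set.Ioi 0) :=
    lorentzGen.contDiff.comp_contDiffOn (hs.prodMk ht)
  obtain ⟨L, h1, h2, h3⟩ := exists_smooth_linear_ode_Ioi
    (T := fun r => (ContinuousLinearMap.compL ℝ Mink Mink Mink).flip (lorentzGen (s r, t r)))
    ((ContinuousLinearMap.contDiff _).comp_contDiffOn hA) (ContinuousLinearMap.id ℝ Mink)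
  obtain ⟨K, k1, -, k3⟩ := exists_smooth_linear_ode_Ioi
    (T := fun r => -ContinuousLinearMap.compL ℝ Mink Mink Mink (lorentzGen (s r, t r)))
    ((ContinuousLinearMap.contDiff _).comp_contDiffOn hA).neg (ContinuousLinearMap.id ℝ Mink)
  exact ⟨L, K, h2, h1, k1, fun r hr => h3 r hr, fun r hr => k3 r hr⟩

namespace IsLorentzFrame

variable {s t : ℝ → Space3} {L K : ℝ → Mink →L[ℝ] Mink} (h : IsLorentzFrame s t L K)
include h

theorem comp_inv {r : ℝ} (hr : 0 < r) : L r ∘L K r = ContinuousLinearMap.id ℝ Mink := by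
  rw [eq_at_one_of_hasDerivAt_zero (f := fun r => L r ∘L K r) (fun r hr => ?_) hr, h.one, h.inv_one,
    ContinuousLinearMap.id_comp]
  refine ((h.hasDerivAt r hr).clm_comp (h.hasDerivAt_inv r hr)).congr_deriv ?_
  refine ContinuousLinearMap.ext fun p => ?_
  simp

theorem apply_inv {r : ℝ} (hr : 0 < r) (p : Mink) : L r (K r p) = p :=
  congrArg (fun T : Mink →L[ℝ] Mink => T p) (h.comp_inv hr)

theorem hasDerivAt_inv_apply {r : ℝ} (hr : 0 < r) (p : Mink) :
    HasDerivAt (fun r => K r p) (-(lorentzGen (s r, t r) (K r p))) r := by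
  simpa using! (h.hasDerivAt_inv r hr).clm_apply (hasDerivAt_const r p)

/-- In K' = -A K the generator stands outermost, so its skewness makes the products of K p and K q
constant. For L, where it acts innermost, the property is deduced from the inverse. -/
theorem isometry_inv {r : ℝ} (hr : 0 < r) : IsMinkIsometry (K r).toLinearMap := by
  intro p q
  have h1 := eq_at_one_of_hasDerivAt_zero (f := fun r => minkForm (K r p) (K r q)) (fun r hr => by
    have hp := h.hasDerivAt_inv_apply hr p
    have hq := h.hasDerivAt_inv_apply hr q
    have := minkFormL.hasFDerivAt_of_bilinear hp.hasFDerivAt hq.hasFDerivAt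
    have h2 := this.hasDerivAt
    refine h2.congr_deriv ?_
    have h3 := minkForm_lorentzGen (s r, t r) (K r p) (K r q)
    simp
    linarith) hr
  simpa [h.inv_one] using! h1

theorem isometry {r : ℝ} (hr : 0 < r) : IsMinkIsometry (L r).toLinearMap := by
  obtain ⟨M, hM, h1, h2⟩ := (h.isometry_inv hr).exists_inverse
  have h3 : (L r).toLinearMap = M := by
    refine LinearMap.ext fun p => ?_
    have h4 : (K r) (M p) = p := congrArg (fun T : Mink →ₗ[ℝ] Mink => T p) h1
    have h5 := h.apply_inv hr (M p)
    rw [h4] at h5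
    exact h5
  rw [h3]
  exact hM

theorem inv_apply {r : ℝ} (hr : 0 < r) (p : Mink) : K r (L r p) = p :=
  (h.isometry hr).injective (h.apply_inv hr (L r p))

/-- The determinant has square 1, is continuous in r and equals 1 at r = 1. The time orientation is
handled in the same way below: the image of the timelike vector (0, 1) cannot have zero time
component. -/
theorem det_pos {r : ℝ} (hr : 0 < r) : 0 < LinearMap.det (L r).toLinearMap := by
  refine pos_of_continuousOn_ne_zero (f := fun r => LinearMap.det (L r).toLinearMap) ?_
    (fun r hr h0 => ?_) ?_ hr
  · exact ContinuousLinearMap.continuous_det.comp_continuousOn h.smooth.continuousOn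
  · have := (h.isometry hr).det_sq
    rw [h0] at this
    norm_num at this
  · rw [h.one]
    change 0 < LinearMap.det (LinearMap.id : Mink →ₗ[ℝ] Mink)
    rw [LinearMap.det_id]
    exact one_pos

theorem future {r : ℝ} (hr : 0 < r) : 0 < ((L r).toLinearMap (0, 1)).2 := by
  refine pos_of_continuousOn_ne_zero (f := fun r => (L r (0, 1)).2) ?_ (fun r hr h0 => ?_) ?_ hr
  · exact continuous_snd.comp_continuousOn (h.smooth.continuousOn.clm_apply continuousOn_const)
  · have h1 := h.isometry hr (0, 1) (0, 1)
    rw [minkForm_self, minkForm_self] at h1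
    simp only [ContinuousLinearMap.coe_coe, h0] at h1
    norm_num at h1
    nlinarith [norm_nonneg (L r (0, 1)).1]
  · rw [h.one]
    simp

theorem future_inv {r : ℝ} (hr : 0 < r) : 0 < ((K r).toLinearMap (0, 1)).2 := by
  have h1 := h.isometry hr (K r (0, 1)) (0, 1)
  have h2 := h.future hr
  simp only [ContinuousLinearMap.coe_coe, h.apply_inv hr] at h1 h2 ⊢
  simp [minkForm] at h1
  linarith

end IsLorentzFrame

end LorentzFrames

/-! ### Orientation of quasi-spheres and the sign of the determinant -/

section Orientation

/-- If `Φ ∘ i_r` is the restriction of a Minkowski isometry `M`, its orientation density is a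
positive multiple of `det M`. -/
theorem exists_pos_orientation_eq {Φ : NullCone → NullCone} (hΦ : IsSmoothConeMap Φ)
    {M : Mink →ₗ[ℝ] Mink} (hM : IsMinkIsometry M) {r : ℝ} (hr : 0 < r)
    (hΦM : ∀ θ : Space3, ‖θ‖ = 1 → coneLift Φ (r • θ) = M (r • θ, r)) {θ u v : Space3}
    (hθ : ‖θ‖ = 1) (hu : inner ℝ θ u = 0) (hv : inner ℝ θ v = 0) :
    ∃ k : ℝ, 0 < k ∧ k * inner ℝ (angular (sphereCoord (Φ ∘ sphereIncl r hr) θ))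
      (cross3 (fderiv ℝ (fun x => angular (sphereCoord (Φ ∘ sphereIncl r hr) x)) θ u)
        (fderiv ℝ (fun x => angular (sphereCoord (Φ ∘ sphereIncl r hr) x)) θ v))
      = LinearMap.det M * (r ^ 3 * inner ℝ θ (cross3 u v)) := by
  have h0 : θ ≠ 0 := norm_ne_zero_iff.1 (by rw [hθ]; exact one_ne_zero)
  have hrθ : r • θ ≠ 0 := smul_ne_zero hr.ne' h0
  have hval : sphereCoord (Φ ∘ sphereIncl r hr) θ = coneCoord Φ (r • θ) := by
    rw [sphereCoord_comp_sphereIncl Φ hr h0, angular_eq_self hθ]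
  set y := coneCoord Φ (r • θ) with hy
  have hy0 : y ≠ 0 := coneCoord_ne_zero Φ hrθ
  have hρ : 0 < ‖y‖ := norm_pos_iff.2 hy0
  have hMθ : M (r • θ, r) = (‖y‖ • angular y, ‖y‖) := by
    rw [← hΦM θ hθ, norm_smul_angular]; rfl
  have hder : ∀ w : Space3, inner ℝ θ w = 0 →
      fderiv ℝ (sphereCoord (Φ ∘ sphereIncl r hr)) θ w = (M (r • w, 0)).1 := by
    intro w hw
    have he : sphereCoord (Φ ∘ sphereIncl r hr) =ᶠ[nhds θ] fun z => (M (r • angular z, r)).1 := by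
      filter_upwards [isOpen_compl_singleton.mem_nhds h0] with z hz
      rw [sphereCoord_comp_sphereIncl Φ hr hz, ← hΦM _ (norm_angular hz)]
      rfl
    have hA : HasFDerivAt (fun z => ((r • angular z, r) : Mink))
        ((r • fderiv ℝ angular θ).prod 0) θ :=
      ((differentiableAt_angular h0).hasFDerivAt.const_smul r).prodMk (hasFDerivAt_const r θ)
    have hB := (M.toContinuousLinearMap.hasFDerivAt.comp θ hA).fst
    have hC := hB.congr_of_eventuallyEq he
    rw [hC.fderiv]
    simp [fderiv_angular_tangent hθ hw]
  -- The vector (rw, 0) is orthogonal to the generator (rθ, r), and M preserves this.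
  have hsnd : ∀ w : Space3, inner ℝ θ w = 0 →
      (M (r • w, 0)).2 = inner ℝ (angular y) (M (r • w, 0)).1 := by
    intro w hw
    have h1 := hM (r • θ, r) (r • w, 0)
    rw [hMθ] at h1
    simp only [minkForm, real_inner_smul_left, real_inner_smul_right, hw] at h1
    have h2 : ‖y‖ * (inner ℝ (angular y) (M (r • w, 0)).1 - (M (r • w, 0)).2) = 0 := by linarith
    linarith [(mul_eq_zero.1 h2).resolve_left hρ.ne']
  have hang : ∀ w : Space3, inner ℝ θ w = 0 →
      fderiv ℝ (fun x => angular (sphereCoord (Φ ∘ sphereIncl r hr) x)) θ w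
        = fderiv ℝ angular y (M (r • w, 0)).1 := by
    intro w hw
    rw [← hder w hw]
    have hd := (hasFDerivAt_sphereCoord hΦ hr hθ).differentiableAt
    have ha : DifferentiableAt ℝ angular (sphereCoord (Φ ∘ sphereIncl r hr) θ) := by
      rw [hval]; exact differentiableAt_angular hy0
    have := (ha.hasFDerivAt.comp θ hd.hasFDerivAt).fderiv
    rw [hval] at this
    exact congrArg (fun T => T w) this
  have hframe : ∀ w : Space3, inner ℝ θ w = 0 → M (r • w, 0) = ((M (r • w, 0)).2 • angular y
      + ‖y‖ • fderiv ℝ angular y (M (r • w, 0)).1, (M (r • w, 0)).2) := by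
    intro w hw
    refine Prod.ext ?_ rfl
    rw [fderiv_angular hy0, smul_smul, mul_inv_cancel₀ hρ.ne', hsnd w hw]
    simp
  have key := det_orientation (norm_angular hy0) (inner_angular_fderiv_angular hy0 _)
    (inner_angular_fderiv_angular hy0 _) hMθ (hframe u hu) (hframe v hv)
  -- The product of the generator (rθ, r) with (0, 1) is -r and is preserved by M; so the factor in
  -- `det_orientation` is positive.
  have htime : (M (0, 1)).2 - inner ℝ (angular y) (M (0, 1)).1 = r / ‖y‖ := by
    have h1 := hM (r • θ, r) (0, 1)
    rw [hMθ] at h1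
    simp only [minkForm, real_inner_smul_left, inner_zero_right] at h1
    rw [eq_div_iff hρ.ne']
    linarith
  rw [htime] at key
  refine ⟨‖y‖ ^ 3 * (r / ‖y‖), by positivity, ?_⟩
  rw [hang u hu, hang v hv, hval]
  exact key

end Orientation

/-! ### Smooth dependence of the ℓ = 1 coefficients on r -/

section ShearCoefficients

theorem IsShearVector.contDiffOn_radial {β : ℝ → Space3 → Space3} (hβ : IsShearVector β)
    {θ : Space3} (hθ : ‖θ‖ = 1) : ContDiffOn ℝ ∞ (fun r => β r θ) (Set.Ioi 0) := by
  have h0 : θ ≠ 0 := norm_ne_zero_iff.1 (by rw [hθ]; exact one_ne_zero)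
  have h1 : ContDiffOn ℝ ∞ (fun r : ℝ => r • θ) (Set.Ioi 0) :=
    (contDiff_id.smul contDiff_const).contDiffOn
  refine (hβ.1.comp h1 fun r hr => smul_ne_zero (Set.mem_Ioi.1 hr).ne' h0).congr fun r hr => ?_
  simp only [Function.comp_apply]
  rw [angular_smul hr, angular_eq_self hθ, norm_smul, hθ, Real.norm_of_nonneg (Set.mem_Ioi.1 hr).le,
    mul_one]

theorem exists_smooth_coefficients {β : ℝ → Space3 → Space3} (hβ : IsShearVector β)
    (hβ₁ : IsPureEllOne β) : ∃ s t : ℝ → Space3, ContDiffOn ℝ ∞ s (Set.Ioi 0) ∧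
      ContDiffOn ℝ ∞ t (Set.Ioi 0) ∧ ∀ r : ℝ, 0 < r → ∀ θ : Space3, ‖θ‖ = 1 →
        β r θ = r • (t r - (inner ℝ θ (t r) : ℝ) • θ) + r • cross3 θ (s r) := by
  set e₀ : Space3 := !₂[1, 0, 0] with he₀
  set e₁ : Space3 := !₂[0, 1, 0] with he₁
  have n₀ : ‖e₀‖ = 1 := by simp [he₀, EuclideanSpace.norm_eq, Fin.sum_univ_three]
  have n₁ : ‖e₁‖ = 1 := by simp [he₁, EuclideanSpace.norm_eq, Fin.sum_univ_three]
  have m₀ : ‖-e₀‖ = 1 := by rw [norm_neg, n₀]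
  have m₁ : ‖-e₁‖ = 1 := by rw [norm_neg, n₁]
  have hsm : ∀ (θ : Space3) (i : Fin 3), ‖θ‖ = 1 →
      ContDiffOn ℝ ∞ (fun r => β r θ i) (Set.Ioi 0) := fun θ i hθ =>
    (contDiffOn_euclidean.1 (hβ.contDiffOn_radial hθ)) i
  have hinv : ContDiffOn ℝ ∞ (fun r : ℝ => (2 * r)⁻¹) (Set.Ioi 0) :=
    (contDiff_const.mul contDiff_id).contDiffOn.inv fun r hr =>
      mul_ne_zero two_ne_zero (Set.mem_Ioi.1 hr).ne'
  have hadd : ∀ (θ : Space3) (i : Fin 3), ‖θ‖ = 1 →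
      ContDiffOn ℝ ∞ (fun r => (2 * r)⁻¹ * (β r θ i + β r (-θ) i)) (Set.Ioi 0) := fun θ i hθ =>
    hinv.mul ((hsm θ i hθ).add (hsm (-θ) i (by rw [norm_neg, hθ])))
  have hsub : ∀ (θ : Space3) (i : Fin 3), ‖θ‖ = 1 →
      ContDiffOn ℝ ∞ (fun r => (2 * r)⁻¹ * (β r θ i - β r (-θ) i)) (Set.Ioi 0) := fun θ i hθ =>
    hinv.mul ((hsm θ i hθ).sub (hsm (-θ) i (by rw [norm_neg, hθ])))
  -- The boost part of β is even in θ and the rotation part odd. Sums and differences at ±e₀ and ±e₁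
  -- thus isolate the components of t and s by formulas smooth in r.
  refine ⟨fun r => !₂[-((2 * r)⁻¹ * (β r e₁ 2 - β r (-e₁) 2)),
      (2 * r)⁻¹ * (β r e₀ 2 - β r (-e₀) 2), -((2 * r)⁻¹ * (β r e₀ 1 - β r (-e₀) 1))],
    fun r => !₂[(2 * r)⁻¹ * (β r e₁ 0 + β r (-e₁) 0), (2 * r)⁻¹ * (β r e₀ 1 + β r (-e₀) 1),
      (2 * r)⁻¹ * (β r e₀ 2 + β r (-e₀) 2)], ?_, ?_, ?_⟩
  · rw [contDiffOn_euclidean]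
    intro i
    fin_cases i
    · exact (hsub e₁ 2 n₁).neg
    · exact hsub e₀ 2 n₀
    · exact (hsub e₀ 1 n₀).neg
  · rw [contDiffOn_euclidean]
    intro i
    fin_cases i
    · exact hadd e₁ 0 n₁
    · exact hadd e₀ 1 n₀
    · exact hadd e₀ 2 n₀
  · intro r hr θ hθ
    obtain ⟨s, t, hst⟩ := hβ₁ r hr
    have hs : !₂[-((2 * r)⁻¹ * (β r e₁ 2 - β r (-e₁) 2)),
      (2 * r)⁻¹ * (β r e₀ 2 - β r (-e₀) 2), -((2 * r)⁻¹ * (β r e₀ 1 - β r (-e₀) 1))] = s := by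
      rw [hst _ n₀, hst _ n₁, hst _ m₀, hst _ m₁]
      apply space3_ext <;> simp [he₀, he₁, inner_space3] <;> field_simp <;> ring
    have ht : !₂[(2 * r)⁻¹ * (β r e₁ 0 + β r (-e₁) 0), (2 * r)⁻¹ * (β r e₀ 1 + β r (-e₀) 1),
      (2 * r)⁻¹ * (β r e₀ 2 + β r (-e₀) 2)] = t := by
      rw [hst _ n₀, hst _ n₁, hst _ m₀, hst _ m₁]
      apply space3_ext <;> simp [he₀, he₁, inner_space3] <;> field_simp <;> ring
    simp only [hs, ht]
    exact hst θ hθ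

end ShearCoefficients

/-! ### Recognizing quasi-spheres -/

section QuasiSpheres

theorem coneForm_tangent {Φ : NullCone → NullCone} {β : ℝ → Space3 → Space3}
    (hp : PullsBackTo Φ β) {r : ℝ} (hr : 0 < r) {θ : Space3} (hθ : ‖θ‖ = 1) {v : Space3}
    (hv : inner ℝ θ v = 0) :
    coneForm (coneCoord Φ (r • θ)) (fderiv ℝ (coneCoord Φ) (r • θ) v) = ‖v‖ ^ 2 := by
  have h0 : r • θ ≠ 0 :=
    smul_ne_zero hr.ne' (norm_ne_zero_iff.1 (by rw [hθ]; exact one_ne_zero))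
  rw [hp _ h0, quasiSphericalForm_eq β h0, angular_smul hr, angular_eq_self hθ, hv]
  simp

theorem continuous_comp_sphereIncl {Φ : NullCone → NullCone} (hΦ : IsSmoothConeMap Φ) {r : ℝ}
    (hr : 0 < r) : Continuous (Φ ∘ sphereIncl r hr) := by
  rw [continuous_induced_rng, continuous_iff_continuousAt]
  intro θ
  have hθ : ‖(θ : Space3)‖ = 1 := by simp
  have h0 : ∀ θ : S2, r • (θ : Space3) ≠ 0 := fun θ =>
    smul_ne_zero hr.ne' (norm_ne_zero_iff.1 (by simp))
  have he : (Subtype.val ∘ Φ ∘ sphereIncl r hr) = fun θ : S2 => coneLift Φ (r • (θ : Space3)) := by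
    funext θ
    rw [coneLift_eq Φ (h0 θ), Function.comp_apply, Function.comp_apply]
    congr 2
    apply Subtype.ext
    simp [sphereIncl, NullCone.ofSpace, norm_smul, abs_of_pos hr]
  rw [he]
  exact ContinuousAt.comp (f := fun θ : S2 => r • (θ : Space3))
    (hΦ.contDiffAt_coneLift (h0 θ)).continuousAt
    (continuous_subtype_val.const_smul r).continuousAt

/-- Along a sphere dr = 0, so the form reduces to r²|dθ|². Its definiteness gives the immersion
property, and compactness of S² turns injectivity into an embedding. -/
theorem isQuasiSphere_of_injective {Φ : NullCone → NullCone} {β : ℝ → Space3 → Space3}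
    (hΦ : IsSmoothConeMap Φ) (hp : PullsBackTo Φ β) {r : ℝ} (hr : 0 < r)
    (hinj : Function.Injective (Φ ∘ sphereIncl r hr))
    (ho : PreservesOrientation (Φ ∘ sphereIncl r hr)) :
    IsQuasiSphere r (Φ ∘ sphereIncl r hr) := by
  have hpull : ∀ θ : Space3, ‖θ‖ = 1 → ∀ v : Space3, inner ℝ θ v = 0 →
      coneForm (sphereCoord (Φ ∘ sphereIncl r hr) θ)
        (fderiv ℝ (sphereCoord (Φ ∘ sphereIncl r hr)) θ v) = r ^ 2 * ‖v‖ ^ 2 := by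
    intro θ hθ v hv
    have h0 : θ ≠ 0 := norm_ne_zero_iff.1 (by rw [hθ]; exact one_ne_zero)
    rw [fderiv_sphereCoord_tangent hΦ hr hθ hv, sphereCoord_comp_sphereIncl Φ hr h0,
      angular_eq_self hθ, coneForm_tangent hp hr hθ (by rw [inner_smul_right, hv, mul_zero]),
      norm_smul, mul_pow, Real.norm_of_nonneg hr.le]
  refine ⟨?_, ((continuous_comp_sphereIncl hΦ hr).isClosedEmbedding hinj).isEmbedding,
    fun θ hθ v hv hd => ?_, ho, hpull⟩
  · refine ContDiffOn.congr (f := fun x => coneCoord Φ (r • angular x)) ?_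
      fun x hx => sphereCoord_comp_sphereIncl Φ hr hx
    exact ContDiffOn.comp hΦ (contDiffOn_angular.const_smul r)
      fun x hx => smul_ne_zero hr.ne' (angular_ne_zero hx)
  · have h1 := hpull θ hθ v hv
    have h2 : r ^ 2 * ‖v‖ ^ 2 = 0 := by
      rw [← h1, hd, coneForm]
      simp
    have h3 := (mul_eq_zero.1 h2).resolve_left (pow_ne_zero 2 hr.ne')
    exact norm_eq_zero.1 (pow_eq_zero_iff two_ne_zero |>.1 h3)

end QuasiSpheres

/-! ### Existence: the map defined by a Lorentz frame -/

section Existence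

variable {s t : ℝ → Space3} {L K : ℝ → Mink →L[ℝ] Mink}

/-- The map of the cone which acts on the sphere of radius `r` by the Lorentz transformation
`L r`. -/
def frameMap (h : IsLorentzFrame s t L K) (p : NullCone) : NullCone :=
  ⟨L ‖p.1.1‖ p.1, by
    have hr := norm_pos_iff.2 p.2.2
    have h1 := (h.isometry hr).map_null (h.future hr) p.2.2
    have h2 : ((p.1.1, ‖p.1.1‖) : Mink) = p.1 := Prod.ext rfl p.2.1.symm
    rwa [h2] at h1⟩

theorem coneLift_frameMap (h : IsLorentzFrame s t L K) {x : Space3} (hx : x ≠ 0) :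
    coneLift (frameMap h) x = L ‖x‖ (x, ‖x‖) := by
  rw [coneLift_eq _ hx]
  rfl

theorem contDiffOn_frame (h : IsLorentzFrame s t L K) :
    ContDiffOn ℝ ∞ (fun x : Space3 => L ‖x‖ (x, ‖x‖)) {0}ᶜ := by
  have hn : ContDiffOn ℝ ∞ (fun x : Space3 => ‖x‖) {0}ᶜ := fun x hx =>
    (contDiffAt_norm ℝ hx).contDiffWithinAt
  exact (h.smooth.comp hn fun x hx => Set.mem_Ioi.2 (norm_pos_iff.2 hx)).clm_apply
    (contDiffOn_id.prodMk hn)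

theorem isSmoothConeMap_frameMap (h : IsLorentzFrame s t L K) : IsSmoothConeMap (frameMap h) :=
  (contDiff_fst.comp_contDiffOn (contDiffOn_frame h)).congr fun _ hx =>
    congrArg Prod.fst (coneLift_frameMap h hx)

theorem fderiv_coneLift_frameMap (h : IsLorentzFrame s t L K) {x : Space3} (hx : x ≠ 0)
    (v : Space3) : fderiv ℝ (coneLift (frameMap h)) x v
      = L ‖x‖ ((inner ℝ (angular x) v : ℝ) • lorentzGen (s ‖x‖, t ‖x‖) (x, ‖x‖)
          + (v, inner ℝ (angular x) v)) := by
  have hn := hasFDerivAt_norm_space3 hx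
  have h1 := ((h.hasDerivAt ‖x‖ (norm_pos_iff.2 hx)).hasFDerivAt.comp x hn).clm_apply
    ((hasFDerivAt_id x).prodMk hn)
  have he : coneLift (frameMap h) =ᶠ[nhds x] fun x => L ‖x‖ (x, ‖x‖) := by
    filter_upwards [isOpen_compl_singleton.mem_nhds hx] with z hz
    exact coneLift_frameMap h hz
  have h2 := (h1.congr_of_eventuallyEq he).fderiv
  rw [h2, map_add, map_smul]
  simp [add_comm]

/-- The isometry L r drops out of the Minkowski form. What remains is a vector (w, z · w) tangent to
the cone at x, with form equal to the squared norm of the part of w orthogonal to z = x/‖x‖; that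
part is r dθ + β dr. -/
theorem pullsBackTo_frameMap (h : IsLorentzFrame s t L K) {β : ℝ → Space3 → Space3}
    (hβ : ∀ r : ℝ, 0 < r → ∀ θ : Space3, ‖θ‖ = 1 →
        β r θ = r • (t r - (inner ℝ θ (t r) : ℝ) • θ) + r • cross3 θ (s r)) :
    PullsBackTo (frameMap h) β := by
  intro x hx v
  have hr := norm_pos_iff.2 hx
  rw [coneForm_fderiv (isSmoothConeMap_frameMap h) hx, fderiv_coneLift_frameMap h hx]
  refine (h.isometry hr _ _).trans ?_
  rw [quasiSphericalForm_eq β hx, hβ _ hr _ (norm_angular hx), lorentzGen_apply]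
  have hx' : x = ‖x‖ • angular x := (norm_smul_angular x).symm
  set z := angular x with hz
  set r := ‖x‖ with hrdef
  have hz1 : ‖z‖ = 1 := norm_angular hx
  set c : ℝ := inner ℝ z v with hc
  set w : Space3 := c • (r • t r + cross3 x (s r)) + v with hw
  have hzw : inner ℝ z w = c * inner ℝ x (t r) + c := by
    rw [hw, hx', inner_add_right, inner_smul_right, inner_add_right, inner_smul_right,
      cross3_smul_left, inner_smul_right, inner_cross3_self, real_inner_smul_left]
    ring
  have hL : c • ((r • t r + cross3 x (s r), inner ℝ x (t r)) : Mink) + (v, c)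
      = (w, inner ℝ z w) := by
    rw [hzw]; rfl
  have hR : v - c • z + c • (r • (t r - (inner ℝ z (t r) : ℝ) • z) + r • cross3 z (s r))
      = w - (inner ℝ z w : ℝ) • z := by
    rw [hzw, hw, hx', cross3_smul_left, real_inner_smul_left]
    module
  rw [hL, hR, norm_sub_inner_smul_sq hz1, minkForm_self]

theorem injective_frameMap_sphere (h : IsLorentzFrame s t L K) {r : ℝ} (hr : 0 < r) :
    Function.Injective (frameMap h ∘ sphereIncl r hr) := by
  intro θ θ' hθ
  have hn : ∀ θ : S2, ‖r • (θ : Space3)‖ = r := fun θ => by simp [norm_smul, abs_of_pos hr]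
  have h1 : L ‖r • (θ : Space3)‖ (r • (θ : Space3), r)
      = L ‖r • (θ' : Space3)‖ (r • (θ' : Space3), r) := congrArg Subtype.val hθ
  rw [hn, hn] at h1
  have h2 := (h.isometry hr).injective h1
  exact Subtype.ext (smul_right_injective _ hr.ne' (congrArg Prod.fst h2))

theorem preservesOrientation_frameMap (h : IsLorentzFrame s t L K) {r : ℝ} (hr : 0 < r) :
    PreservesOrientation (frameMap h ∘ sphereIncl r hr) := by
  intro θ hθ u v hu hv huv
  have h0 : ∀ θ : Space3, ‖θ‖ = 1 → coneLift (frameMap h) (r • θ)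
      = (L r).toLinearMap (r • θ, r) := by
    intro θ hθ
    have hn : ‖r • θ‖ = r := by rw [norm_smul, hθ, mul_one, Real.norm_of_nonneg hr.le]
    rw [coneLift_frameMap h (norm_ne_zero_iff.1 (by rw [hn]; exact hr.ne')), hn]
    rfl
  obtain ⟨k, hk, hkey⟩ := exists_pos_orientation_eq (isSmoothConeMap_frameMap h) (h.isometry hr) hr
    h0 hθ hu hv
  have hpos : 0 < LinearMap.det (L r).toLinearMap * (r ^ 3 * inner ℝ θ (cross3 u v)) :=
    mul_pos (h.det_pos hr) (by positivity)
  rw [← hkey] at hpos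
  exact (pos_iff_pos_of_mul_pos hpos).1 hk

theorem isQuasiSphericalMap_frameMap (h : IsLorentzFrame s t L K) {β : ℝ → Space3 → Space3}
    (hβ : ∀ r : ℝ, 0 < r → ∀ θ : Space3, ‖θ‖ = 1 →
        β r θ = r • (t r - (inner ℝ θ (t r) : ℝ) • θ) + r • cross3 θ (s r)) :
    IsQuasiSphericalMap (frameMap h) :=
  ⟨isSmoothConeMap_frameMap h, fun _ hr => isQuasiSphere_of_injective (isSmoothConeMap_frameMap h)
    (pullsBackTo_frameMap h hβ) hr (injective_frameMap_sphere h hr)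
    (preservesOrientation_frameMap h hr)⟩

end Existence

/-! ### A solution acts on each sphere by a Lorentz transformation -/

section Spheres

variable {Φ : NullCone → NullCone} {β : ℝ → Space3 → Space3}

theorem coneLift_ne_zero (Φ : NullCone → NullCone) {x : Space3} (hx : x ≠ 0) : coneLift Φ x ≠ 0 :=
  fun h => coneCoord_ne_zero Φ hx (congrArg Prod.fst h)

theorem minkForm_coneLift (Φ : NullCone → NullCone) (x : Space3) :
    minkForm (coneLift Φ x) (coneLift Φ x) = 0 := by
  rw [minkForm_self, coneLift, sub_self]

theorem minkForm_coneLift_fderiv (hΦ : IsSmoothConeMap Φ) {x : Space3} (hx : x ≠ 0) (v : Space3) :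
    minkForm (coneLift Φ x) (fderiv ℝ (coneLift Φ) x v) = 0 := by
  have hd : HasFDerivAt (coneLift Φ) _ x :=
    hasFDerivAt_nullLift (hΦ.differentiableAt hx).hasFDerivAt (coneCoord_ne_zero Φ hx)
  rw [hd.fderiv]
  change inner ℝ (coneCoord Φ x) (fderiv ℝ (coneCoord Φ) x v)
    - ‖coneCoord Φ x‖ * inner ℝ (angular (coneCoord Φ x)) (fderiv ℝ (coneCoord Φ) x v) = 0
  rw [← real_inner_smul_left, norm_smul_angular, sub_self]

/-- The homogeneous extension of the restriction of a map of the cone to the sphere of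
radius `r`. -/
def sphereExtension (Φ : NullCone → NullCone) (r : ℝ) (x : Space3) : Mink :=
  (‖x‖ / r) • coneLift Φ (r • angular x)

/-- Differentiating the scale factor contributes a multiple of the null position vector, which is
orthogonal to the tangent space of the cone; only the angular derivative counts, and along the
sphere it is isometric. -/
theorem isConeIsometry_sphereExtension (hΦ : IsSmoothConeMap Φ) (hp : PullsBackTo Φ β) {r : ℝ}
    (hr : 0 < r) : IsConeIsometry (sphereExtension Φ r) where
  smooth := by
    intro x hx
    have h1 : r • angular x ≠ 0 := smul_ne_zero hr.ne' (angular_ne_zero hx)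
    have h2 : ContDiffAt ℝ ∞ angular x :=
      contDiffOn_angular.contDiffAt (isOpen_compl_singleton.mem_nhds hx)
    exact (((contDiffAt_norm ℝ hx).div_const r).smul
      ((hΦ.contDiffAt_coneLift h1).comp x (h2.const_smul r))).contDiffWithinAt
  homogeneous c hc x := by
    rw [sphereExtension, sphereExtension, angular_smul hc, norm_smul, Real.norm_of_nonneg hc.le,
      smul_smul, mul_div_assoc]
  ne_zero x hx := smul_ne_zero (div_ne_zero (norm_ne_zero_iff.2 hx) hr.ne')
    (coneLift_ne_zero Φ (smul_ne_zero hr.ne' (angular_ne_zero hx)))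
  null x _ := by
    rw [sphereExtension, minkForm_smul_left, minkForm_smul_right, minkForm_coneLift]
    simp
  isometric x hx v := by
    have h1 : r • angular x ≠ 0 := smul_ne_zero hr.ne' (angular_ne_zero hx)
    have hF := ((hΦ.contDiffAt_coneLift h1).differentiableAt (by simp)).hasFDerivAt
    have hG := hF.comp x ((differentiableAt_angular hx).hasFDerivAt.const_smul r)
    have hH : HasFDerivAt (sphereExtension Φ r) _ x :=
      ((hasFDerivAt_norm_space3 hx).mul_const r⁻¹).smul hG
    have hv : inner ℝ (angular x) (fderiv ℝ angular x v) = 0 := inner_angular_fderiv_angular hx v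
    have hv' : inner ℝ (angular x) (r • fderiv ℝ angular x v) = 0 := by
      rw [inner_smul_right, hv, mul_zero]
    have hd : fderiv ℝ (sphereExtension Φ r) x v
        = (‖x‖ * r⁻¹) • fderiv ℝ (coneLift Φ) (r • angular x) (r • fderiv ℝ angular x v)
          + (r⁻¹ * inner ℝ (angular x) v) • coneLift Φ (r • angular x) := by
      rw [hH.fderiv]
      simp
    rw [hd]
    simp only [minkForm_add_left, minkForm_add_right, minkForm_smul_left, minkForm_smul_right,
      minkForm_coneLift, minkForm_coneLift_fderiv hΦ h1,
      minkForm_comm _ (coneLift Φ (r • angular x))]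
    rw [← coneForm_fderiv hΦ h1, coneForm_tangent hp hr (norm_angular hx) hv', ← coneForm_eq hx,
      coneForm, norm_smul, Real.norm_of_nonneg hr.le]
    field_simp
    ring

theorem exists_isSO0_sphere (hΦ : IsSmoothConeMap Φ) (hp : PullsBackTo Φ β) {r : ℝ} (hr : 0 < r)
    (ho : PreservesOrientation (Φ ∘ sphereIncl r hr)) :
    ∃ M : Mink →ₗ[ℝ] Mink, IsSO0 M ∧ ∀ θ : Space3, ‖θ‖ = 1 →
      coneLift Φ (r • θ) = M (r • θ, r) := by
  obtain ⟨M, hM, hext⟩ := (isConeIsometry_sphereExtension hΦ hp hr).exists_linear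
  have hval : ∀ θ : Space3, ‖θ‖ = 1 → coneLift Φ (r • θ) = M (r • θ, r) := by
    intro θ hθ
    have h0 : θ ≠ 0 := norm_ne_zero_iff.1 (by rw [hθ]; exact one_ne_zero)
    have h1 := hext θ h0
    rw [sphereExtension, angular_eq_self hθ, hθ] at h1
    have h2 : ((r • θ, r) : Mink) = r • (θ, 1) := by
      rw [Prod.smul_mk, smul_eq_mul, mul_one]
    rw [h2, map_smul, ← h1, smul_smul, mul_one_div_cancel hr.ne', one_smul]
  set e₀ : Space3 := !₂[1, 0, 0] with he₀
  have n₀ : ‖e₀‖ = 1 := by simp [he₀, EuclideanSpace.norm_eq, Fin.sum_univ_three]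
  have hsnd : ∀ θ : Space3, ‖θ‖ = 1 → 0 < (M (r • θ, r)).2 := by
    intro θ hθ
    rw [← hval θ hθ]
    exact norm_pos_iff.2 (coneCoord_ne_zero Φ
      (smul_ne_zero hr.ne' (norm_ne_zero_iff.1 (by rw [hθ]; exact one_ne_zero))))
  have hfut : 0 < (M (0, 1)).2 := by
    -- The time axis is a sum of two antipodal null vectors, both of which M sends to the future
    -- cone.
    have h1 : ((2 * r) • (0, 1) : Mink) = (r • e₀, r) + (r • (-e₀), r) := by
      refine Prod.ext ?_ ?_ <;> simp
      ring
    have h2 := congrArg (fun p => (M p).2) h1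
    simp only [map_add, map_smul, Prod.snd_add, Prod.smul_snd, smul_eq_mul] at h2
    have h5 : 0 < 2 * r * (M (0, 1)).2 := by
      rw [h2]
      exact add_pos (hsnd e₀ n₀) (hsnd (-e₀) (by rw [norm_neg, n₀]))
    exact (pos_iff_pos_of_mul_pos h5).1 (by positivity)
  have hu : inner ℝ e₀ (!₂[0, 1, 0] : Space3) = 0 := by simp [he₀, inner_space3]
  have hv : inner ℝ e₀ (!₂[0, 0, 1] : Space3) = 0 := by simp [he₀, inner_space3]
  have huv : (0 : ℝ) < inner ℝ e₀ (cross3 !₂[0, 1, 0] !₂[0, 0, 1]) := by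
    simp [he₀, inner_space3]
  obtain ⟨k, hk, hkey⟩ := exists_pos_orientation_eq hΦ hM hr hval n₀ hu hv
  -- Testing orientation at a single point fixes the sign of the determinant, which is ±1.
  have hdet : 0 < LinearMap.det M := by
    have h1 := mul_pos hk (ho e₀ n₀ _ _ hu hv huv)
    rw [hkey] at h1
    exact (pos_iff_pos_of_mul_pos h1).2 (by positivity)
  have hsq := hM.det_sq
  refine ⟨M, ⟨hM, ?_, hfut⟩, hval⟩
  nlinarith

end Spheres

/-! ### Rigidity: comparing different spheres -/

section Rigidity

theorem minkForm_null_ne_zero {η σ : Space3} (hη : ‖η‖ = 1) (hσ : ‖σ‖ = 1) (h : η ≠ σ) :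
    minkForm (η, 1) (σ, 1) ≠ 0 := by
  intro h0
  refine h ((inner_eq_one_iff_of_norm_eq_one (𝕜 := ℝ) hη hσ).1 ?_)
  simp only [minkForm] at h0
  linarith

/-- Minkowski isometries agreeing on all null directions agree on all null vectors. -/
theorem eq_of_null_directions {M N : Mink →ₗ[ℝ] Mink} (hM : IsMinkIsometry M)
    (hN : IsMinkIsometry N)
    (h : ∀ η : Space3, ‖η‖ = 1 → ∃ c : ℝ, 0 < c ∧ N (η, 1) = c • M (η, 1)) {η : Space3}
    (hη : ‖η‖ = 1) : N (η, 1) = M (η, 1) := by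
  choose! c hc hNM using h
  -- Distinct null directions have nonzero product, which both isometries preserve. Applied to three
  -- distinct directions, with positive factors, this forces every factor to be 1.
  have hmul : ∀ σ τ : Space3, ‖σ‖ = 1 → ‖τ‖ = 1 → σ ≠ τ → c σ * c τ = 1 := by
    intro σ τ hσ hτ hne
    have h1 := hN (σ, 1) (τ, 1)
    rw [hNM σ hσ, hNM τ hτ, minkForm_smul_left, minkForm_smul_right, hM, ← mul_assoc] at h1
    exact mul_right_cancel₀ (minkForm_null_ne_zero hσ hτ hne) (h1.trans (one_mul _).symm)
  have hneg : ‖-η‖ = 1 := by rw [norm_neg, hη]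
  have hne : η ≠ -η := fun h => by
    have h1 := congrArg (inner ℝ η) h
    rw [inner_neg_right, real_inner_self_eq_norm_sq, hη] at h1
    norm_num at h1
  obtain ⟨τ, hτ, h1, h2⟩ : ∃ τ : Space3, ‖τ‖ = 1 ∧ η ≠ τ ∧ -η ≠ τ := by
    by_cases h0 : η 0 = 0
    · refine ⟨!₂[1, 0, 0], by simp [EuclideanSpace.norm_eq, Fin.sum_univ_three], fun h => ?_,
        fun h => ?_⟩
      · rw [h] at h0; simp at h0
      · rw [← neg_neg η, h] at h0; simp at h0
    · refine ⟨!₂[0, 1, 0], by simp [EuclideanSpace.norm_eq, Fin.sum_univ_three], fun h => ?_,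
        fun h => ?_⟩
      · rw [h] at h0; simp at h0
      · rw [← neg_neg η, h] at h0; simp at h0
  have e1 := hmul η (-η) hη hneg hne
  have e2 := hmul η τ hη hτ h1
  have e3 := hmul (-η) τ hneg hτ h2
  have hp := hc η hη
  have e4 : c (-η) = c τ := mul_left_cancel₀ hp.ne' (e1.trans e2.symm)
  rw [e4] at e3
  have e5 : c τ = 1 := by nlinarith [hc τ hτ]
  have e6 : c η = 1 := by rw [e5] at e2; linarith
  rw [hNM η hη, e6, one_smul]

/-- The angular part of a curve is differentiable, with the derivative tangent to the sphere. -/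
theorem hasDerivAt_angular_comp {y : ℝ → Space3} {y' : Space3} {r : ℝ} (hy : HasDerivAt y y' r)
    (h0 : y r ≠ 0) : HasDerivAt (fun r => angular (y r)) (fderiv ℝ angular (y r) y') r :=
  (differentiableAt_angular h0).hasFDerivAt.comp_hasDerivAt r hy

variable {s t : ℝ → Space3} {L K : ℝ → Mink →L[ℝ] Mink} {Φ : NullCone → NullCone}
  {β : ℝ → Space3 → Space3}

theorem inv_frame_null (h : IsLorentzFrame s t L K) {r : ℝ} (hr : 0 < r) {η : Space3}
    (hη : ‖η‖ = 1) : (K r (η, 1)).2 = ‖(K r (η, 1)).1‖ ∧ (K r (η, 1)).1 ≠ 0 := by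
  have h1 := (h.isometry_inv hr).map_null (h.future_inv hr)
    (x := η) (norm_ne_zero_iff.1 (by rw [hη]; exact one_ne_zero))
  rwa [hη] at h1

/-- The curve through the spheres which the frame maps to the null direction `η`. -/
def kernelCurve (K : ℝ → Mink →L[ℝ] Mink) (η : Space3) (r : ℝ) : Space3 :=
  r • angular (K r (η, 1)).1

/-- Kernel curves are tangent to the kernel of the quasi-spherical form. -/
theorem exists_hasDerivAt_kernelCurve (h : IsLorentzFrame s t L K)
    (hβ : ∀ r : ℝ, 0 < r → ∀ θ : Space3, ‖θ‖ = 1 →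
        β r θ = r • (t r - (inner ℝ θ (t r) : ℝ) • θ) + r • cross3 θ (s r)) {η : Space3}
    (hη : ‖η‖ = 1) {r : ℝ} (hr : 0 < r) : ∃ c', HasDerivAt (kernelCurve K η) c' r ∧
      quasiSphericalForm β (kernelCurve K η r) c' = 0 := by
  obtain ⟨h1, h2⟩ := inv_frame_null h hr hη
  have hk := (ContinuousLinearMap.fst ℝ Space3 ℝ).hasFDerivAt.comp_hasDerivAt r
    (h.hasDerivAt_inv_apply hr (η, 1))
  have hc : HasDerivAt (kernelCurve K η) _ r :=
    (hasDerivAt_id r).smul (hasDerivAt_angular_comp hk h2)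
  refine ⟨_, hc, ?_⟩
  simp only [ContinuousLinearMap.coe_fst', lorentzGen_apply, id_eq, one_smul,
    Prod.fst_neg, h1]
  set k := (K r (η, 1)).1 with hkdef
  set z := angular k with hz
  have hz1 : ‖z‖ = 1 := norm_angular h2
  have hkn : ‖k‖ ≠ 0 := norm_ne_zero_iff.2 h2
  have hcurve : kernelCurve K η r = r • z := rfl
  have hrz : r • z ≠ 0 := smul_ne_zero hr.ne' (angular_ne_zero h2)
  have hnz : ‖r • z‖ = r := by rw [norm_smul, hz1, mul_one, Real.norm_of_nonneg hr.le]
  -- Since K' = -A K, the direction of K r (η, 1) moves with velocity -β/r, so r dθ + β dr vanishes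
  -- along the curve.
  have hdk : fderiv ℝ angular k (-(‖k‖ • t r + cross3 k (s r)))
      = -(t r - (inner ℝ z (t r) : ℝ) • z + cross3 z (s r)) := by
    have e : ‖k‖ • t r + cross3 k (s r) = ‖k‖ • (t r + cross3 z (s r)) := by
      conv_lhs => rw [← norm_smul_angular k, norm_smul, norm_norm, ← hz, hz1, mul_one,
        cross3_smul_left]
      rw [smul_add]
    rw [fderiv_angular h2, ← hz, e, inner_neg_right, inner_smul_right, inner_add_right,
      inner_cross3_self, add_zero]
    rw [inv_smul_eq_iff₀ hkn]
    module
  rw [hcurve, quasiSphericalForm_eq β hrz, angular_smul hr, angular_eq_self hz1, hnz, hβ r hr z hz1,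
    hdk]
  set w := t r - (inner ℝ z (t r) : ℝ) • z + cross3 z (s r) with hw
  have hzw : inner ℝ z w = 0 := by
    rw [hw, inner_add_right, inner_sub_right, inner_smul_right, inner_cross3_self,
      real_inner_self_eq_norm_sq, hz1]
    ring
  have hzc : inner ℝ z (r • -w + z) = (1 : ℝ) := by
    rw [inner_add_right, inner_smul_right, inner_neg_right, hzw, real_inner_self_eq_norm_sq, hz1]
    ring
  rw [hzc, one_smul, one_smul, ← smul_add, ← hw]
  simp

/-- The angular part of a map pulling back to the form of the frame is constant along kernel
curves. -/
theorem angular_kernelCurve (h : IsLorentzFrame s t L K)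
    (hβ : ∀ r : ℝ, 0 < r → ∀ θ : Space3, ‖θ‖ = 1 →
        β r θ = r • (t r - (inner ℝ θ (t r) : ℝ) • θ) + r • cross3 θ (s r))
    (hΦ : IsSmoothConeMap Φ) (hp : PullsBackTo Φ β) {η : Space3} (hη : ‖η‖ = 1) {r : ℝ}
    (hr : 0 < r) : angular (coneCoord Φ (kernelCurve K η r)) = angular (coneCoord Φ η) := by
  have h1 := eq_at_one_of_hasDerivAt_zero
    (f := fun r => angular (coneCoord Φ (kernelCurve K η r))) (fun r hr => ?_) hr
  · rw [h1, kernelCurve, h.inv_one]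
    simp [angular_eq_self hη]
  · obtain ⟨c', hc, hq⟩ := exists_hasDerivAt_kernelCurve h hβ hη hr
    have hne : kernelCurve K η r ≠ 0 :=
      smul_ne_zero hr.ne' (angular_ne_zero (inv_frame_null h hr hη).2)
    have hy0 := coneCoord_ne_zero Φ hne
    have hd := hasDerivAt_angular_comp
      ((hΦ.differentiableAt hne).hasFDerivAt.comp_hasDerivAt r hc) hy0
    rw [← hp _ hne, coneForm] at hq
    -- The form is |y|² times the squared angular velocity of the image y, and y ≠ 0, so the angular
    -- velocity is zero.
    have h2 := (mul_eq_zero.1 hq).resolve_left (pow_ne_zero 2 (norm_ne_zero_iff.2 hy0))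
    exact hd.congr_deriv (norm_eq_zero.1 (pow_eq_zero_iff two_ne_zero |>.1 h2))

/-- A map pulling back to the form of a Lorentz frame is, up to a fixed Lorentz transformation, the
map defined by the frame. -/
theorem exists_isSO0_frameMap (h : IsLorentzFrame s t L K)
    (hβ : ∀ r : ℝ, 0 < r → ∀ θ : Space3, ‖θ‖ = 1 →
        β r θ = r • (t r - (inner ℝ θ (t r) : ℝ) • θ) + r • cross3 θ (s r))
    (hΦ : IsSmoothConeMap Φ) (hp : PullsBackTo Φ β)
    (ho : ∀ (r : ℝ) (hr : 0 < r), PreservesOrientation (Φ ∘ sphereIncl r hr)) :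
    ∃ M : Mink →ₗ[ℝ] Mink, IsSO0 M ∧ ∀ p : NullCone, (Φ p : Mink) = M (frameMap h p) := by
  choose! M hM hMval using fun (r : ℝ) (hr : 0 < r) => exists_isSO0_sphere hΦ hp hr (ho r hr)
  -- The point of the kernel curve at radius r is a positive multiple of K r (η, 1), and the
  -- solution keeps the whole curve over one direction, the one it has at r = 1, where the curve
  -- passes through η.
  have hdir : ∀ r, 0 < r → ∀ η : Space3, ‖η‖ = 1 →
      ∃ c : ℝ, 0 < c ∧ (M r ∘ₗ (K r).toLinearMap) (η, 1) = c • M 1 (η, 1) := by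
    intro r hr η hη
    obtain ⟨h1, h2⟩ := inv_frame_null h hr hη
    have hη0 : η ≠ 0 := norm_ne_zero_iff.1 (by rw [hη]; exact one_ne_zero)
    set k := (K r (η, 1)).1 with hk
    have hkn := norm_pos_iff.2 h2
    have hne : kernelCurve K η r ≠ 0 := smul_ne_zero hr.ne' (angular_ne_zero h2)
    have hy := norm_pos_iff.2 (coneCoord_ne_zero Φ hne)
    have hy1 := norm_pos_iff.2 (coneCoord_ne_zero Φ hη0)
    have e1 : K r (η, 1) = (‖k‖ / r) • (r • angular k, r) := by
      refine Prod.ext ?_ ?_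
      · rw [Prod.smul_fst, smul_smul, div_mul_cancel₀ _ hr.ne', norm_smul_angular]
      · rw [Prod.smul_snd, smul_eq_mul, div_mul_cancel₀ _ hr.ne', h1]
    have e2 : M r (r • angular k, r) = coneLift Φ (kernelCurve K η r) :=
      (hMval r hr _ (norm_angular h2)).symm
    have e3 : M 1 (η, 1) = coneLift Φ η := by
      have := hMval 1 one_pos η hη
      rw [one_smul] at this
      exact this.symm
    have e4 : ∀ x, coneLift Φ x = ‖coneCoord Φ x‖ • (angular (coneCoord Φ x), (1 : ℝ)) := by
      intro x
      rw [Prod.smul_mk, norm_smul_angular, smul_eq_mul, mul_one]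
      rfl
    refine ⟨‖k‖ / r * ‖coneCoord Φ (kernelCurve K η r)‖ / ‖coneCoord Φ η‖, by positivity, ?_⟩
    rw [LinearMap.comp_apply, ContinuousLinearMap.coe_coe, e1, map_smul, e2, e3, e4, e4 η,
      angular_kernelCurve h hβ hΦ hp hη hr, smul_smul, smul_smul, div_mul_cancel₀ _ hy1.ne']
  refine ⟨M 1, hM 1 one_pos, fun p => ?_⟩
  obtain ⟨⟨x, τ⟩, hτ, hx⟩ := p
  simp only at hτ hx
  subst hτ
  have hr := norm_pos_iff.2 hx
  obtain ⟨h1, h2⟩ := (h.isometry hr).map_null (h.future hr) hx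
  have hxa : ‖x‖ • angular x = x := norm_smul_angular x
  have hΦx := hMval ‖x‖ hr (angular x) (norm_angular hx)
  rw [hxa, coneLift_eq Φ hx] at hΦx
  refine hΦx.trans ?_
  change M ‖x‖ (x, ‖x‖) = M 1 (L ‖x‖ (x, ‖x‖))
  set q := L ‖x‖ (x, ‖x‖) with hq
  have hq1 : q = ‖q.1‖ • (angular q.1, (1 : ℝ)) := by
    refine Prod.ext (norm_smul_angular _).symm ?_
    rw [Prod.smul_snd, smul_eq_mul, mul_one]
    exact h1
  -- Writing x as the image of q under K turns the goal into the equality of M r ∘ K r and M 1 on a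
  -- null vector.
  have hxq : ((x, ‖x‖) : Mink) = K ‖x‖ q := (h.inv_apply hr _).symm
  rw [hxq, hq1, map_smul, map_smul, map_smul]
  congr 1
  exact eq_of_null_directions (hM 1 one_pos).1 (IsMinkIsometry.comp (hM ‖x‖ hr).1 (h.isometry_inv hr))
    (hdir ‖x‖ hr) (norm_angular h2)

theorem IsSO0.exists_inverse {L : Mink →ₗ[ℝ] Mink} (hL : IsSO0 L) :
    ∃ K : Mink →ₗ[ℝ] Mink, IsSO0 K ∧ K ∘ₗ L = LinearMap.id := by
  obtain ⟨K, hK, h1, h2⟩ := IsMinkIsometry.exists_inverse hL.1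
  refine ⟨K, ⟨hK, ?_, ?_⟩, h2⟩
  · have h3 := congrArg LinearMap.det h2
    rwa [LinearMap.det_comp, hL.2.1, mul_one, LinearMap.det_id] at h3
  · have h3 := hL.1 (K (0, 1)) (0, 1)
    have h4 : L (K (0, 1)) = (0, 1) := congrArg (fun T : Mink →ₗ[ℝ] Mink => T (0, 1)) h1
    have h5 := hL.2.2
    rw [h4] at h3
    simp [minkForm] at h3
    linarith

theorem IsSO0.comp {L K : Mink →ₗ[ℝ] Mink} (hL : IsSO0 L) (hK : IsSO0 K) : IsSO0 (L ∘ₗ K) := by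
  refine ⟨IsMinkIsometry.comp hL.1 hK.1, ?_, ?_⟩
  · rw [LinearMap.det_comp, hL.2.1, hK.2.1, mul_one]
  · have h1 := hK.1 (0, 1) (0, 1)
    have h2 := hK.2.2
    have h3 : (0 : ℝ) < (K (0, 1)).2 := h2
    rw [minkForm_self, minkForm_self] at h1
    refine IsMinkIsometry.snd_pos hL.1 hL.2.2 (q := K (0, 1)) (fun h0 => ?_) ?_
    · rw [h0] at h3; exact lt_irrefl _ h3
    · refine (abs_le_of_sq_le_sq' ?_ h3.le).2
      simp at h1
      linarith

end Rigidity

end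

/-! ### The theorem: existence, and uniqueness up to a Lorentz transformation -/

theorem corollary4 (β : ℝ → Space3 → Space3) (hβ : IsShearVector β) (hβ₁ : IsPureEllOne β) :
    (∃ Φ : NullCone → NullCone, IsQuasiSphericalMap Φ ∧ PullsBackTo Φ β) ∧
    ∀ Φ Φ' : NullCone → NullCone,
      IsQuasiSphericalMap Φ → PullsBackTo Φ β →
      IsSmoothConeMap Φ' →
      (∀ (r : ℝ) (hr : 0 < r), PreservesOrientation (Φ' ∘ sphereIncl r hr)) →
      PullsBackTo Φ' β →
      ∃ L₀ : Mink →ₗ[ℝ] Mink, IsSO0 L₀ ∧ ∀ p : NullCone, (Φ' p : Mink) = L₀ (Φ p : Mink) := by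
  obtain ⟨s, t, hs, ht, hst⟩ := exists_smooth_coefficients hβ hβ₁
  obtain ⟨L, K, h⟩ := exists_lorentzFrame hs ht
  refine ⟨⟨frameMap h, isQuasiSphericalMap_frameMap h hst, pullsBackTo_frameMap h hst⟩, ?_⟩
  intro Φ Φ' hΦ hp hΦ' ho' hp'
  obtain ⟨M, hM, hMΦ⟩ := exists_isSO0_frameMap h hst hΦ.1 hp fun r hr => (hΦ.2 r hr).orientation
  obtain ⟨M', hM', hMΦ'⟩ := exists_isSO0_frameMap h hst hΦ' hp' ho'
  obtain ⟨N, hN, hNM⟩ := hM.exists_inverse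
  -- Both maps are Lorentz transforms M and M' of the same frame map, so M' ∘ M⁻¹ carries one to the
  -- other.
  refine ⟨M' ∘ₗ N, hM'.comp hN, fun p => ?_⟩
  rw [LinearMap.comp_apply, hMΦ p, hMΦ' p]
  exact congrArg M' (congrArg (fun T : Mink →ₗ[ℝ] Mink => T (frameMap h p)) hNM).symm
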